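/- Let $K$ be a field complete with respect to a discrete valuation $\mathrm{val}$, with ring of integers $K^\circ$, uniformizer $\pi$ and residue field $\bar K=K^\circ/\pi$. For $\mathbf r\in\mathbb Q^n$, let $K\{\mathbf X;\mathbf r\}$ be the Tate algebra of all series $\sum a_{\mathbf i}\mathbf X^{\mathbf i}$ over $K$ in $\mathbf X=(X_1,\dots,X_n)$ with $\mathrm{val}(a_{\mathbf i})-\mathbf r\cdot\mathbf i\to+\infty$ as $|\mathbf i|\to\infty$; its Gauss valuation is $\min_{\mathbf i}\big(\mathrm{val}(a_{\mathbf i})-\mathbf r\cdot\mathbf i\big)$, and $K\{\mathbf X\}=K\{\mathbf X;\mathbf 0\}$. Fix a monomial order $\le$. Nonzero terms of $K\{\mathbf X\}$ are compared by Gauss valuation (the larger the valuation, the smaller the term), ties being broken by $\le$ on the monomials; the leading term of a nonzero series is its largest term. A Gröbner basis of an ideal $J\subset K\{\mathbf X\}$ is a finite family $G\subset J$ such that the leading term of every nonzero $f\in J$ is divisible by the leading term of some $g\in G$. Let $\mathbf r\in\mathbb Q^n$ with all $r_i\ge 0$, let $I$ be an ideal of $K\{\mathbf X;\mathbf r\}$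 with $\dim_K K\{\mathbf X;\mathbf r\}/I<\infty$, and put $J=I\cdot K\{\mathbf X\}$, $W=K\{\mathbf X\}/J$, $\delta=\dim_K W$. Let $D\subset W$ be the unit ball for the quotient of the Gauss norm. The input of Algorithm $\mathtt{GB}$ consists of $\le$, the matrices $U_1,\dots,U_n\in (K^\circ)^{\delta\times\delta}$ of multiplication by $X_1,\dots,X_n$ in some $K^\circ$-basis of $D$, and the coordinate vector $w\in(K^\circ)^\delta$ of $1$ in this basis. Algorithm $\mathtt{GB}$ is as follows. 1. Reduce the $U_i$ and $w$ modulo $\pi$ and run the classical FGLM algorithm over the field $\bar K$ on these data, for $\le$. (It considers monomials in increasing order, starting with $1$; a monomial that is a multiple of a leading monomial already found is skipped; otherwise its coordinate vector is computed by one matrix-vector product and tested, by incremental elimination, for linear dependence on the vectors of the current staircase; if dependent, the relation gives a new element of the basis, and if independent, the monomial joins the staircase and its multiples by $X_1,\dots,X_n$ become candidates.) Let $\bar G$ be the resulting Gröbner basis and $B$ the staircase, that is, the set of monomials divisible by no $\mathrm{LM}(g)$, $g\in\bar G$. 2. Compute the matrix $M$ whose columns are the coordinate vectors $M_\mu$ of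 $\mu\in B$: $M_1=w$, and, in increasing order, $M_\mu=U_iM_{\mu'}$ where $\mu=X_i\mu'$ with $\mu'\in B$. 3. For $m\in\mathrm{LM}(\bar G)$ compute the coordinate vector $N_m=U_iM_\mu$ where $m=X_i\mu$ with $\mu\in B$ ($N_1=w$ if $m=1$). 4. Compute $Q=M^{-1}N$ by elimination and return $G=\big(m-\sum_{\mu\in B}Q_{\mu,m}\,\mu\big)_{m\in\mathrm{LM}(\bar G)}$. **Proposition.** Algorithm $\mathtt{GB}$ is correct: its output $G$ is a Gröbner basis of $J$. Moreover, for $n\ge 1$, it performs $O(n\delta^3)$ arithmetic operations, where additions, subtractions, multiplications, divisions and zero tests in $K$ and in $\bar K$, reductions of elements of $K^\circ$ modulo $\pi$ and inclusions of elements of $K^\circ$ in $K$ each count as one operation, and the implied constant is absolute (independent of $K$, $n$, $\le$, $\mathbf r$, $I$, $\delta$ and the chosen basis of $D$). -/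

import Mathlib

open scoped WithZero Valued

noncomputable section

namespace TateFGLM

/-! ## Tate algebras over a complete discretely valued field -/

section Tate

variable (K : Type*) [Field K] [Valued K ℤᵐ⁰] {n : ℕ}

/-- The additive valuation of a nonzero element of `K`, as an integer
(the value at `0` is irrelevant: it is never used). -/
def ord (a : K) : ℤ := -WithZero.log (Valued.v a)

variable {K}

/-- The Gauss valuation `val(a) - r·i` of the term `a X^i` with `a ≠ 0`. -/
def termVal (r : Fin n → ℚ) (a : K) (i : Fin n →₀ ℕ) : ℚ := (ord K a : ℚ) - ∑ j, r j * (i j : ℚ)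

/-- The convergence condition `val(a_i) - r·i → +∞` as `|i| → ∞`: below any bound there
are only finitely many (nonzero) terms. -/
def IsConvergent (r : Fin n → ℚ) (f : MvPowerSeries (Fin n) K) : Prop :=
  ∀ C : ℚ, {i | MvPowerSeries.coeff i f ≠ 0 ∧ termVal r (MvPowerSeries.coeff i f) i < C}.Finite

theorem ord_mul {a b : K} (ha : a ≠ 0) (hb : b ≠ 0) : ord K (a * b) = ord K a + ord K b := by
  have ha' : Valued.v a ≠ (0 : ℤᵐ⁰) := (Valuation.ne_zero_iff _).2 ha
  have hb' : Valued.v b ≠ (0 : ℤᵐ⁰) := (Valuation.ne_zero_iff _).2 hb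
  simp only [ord, map_mul, WithZero.log_mul ha' hb']
  ring

theorem ord_one : ord K (1 : K) = 0 := by simp [ord]

theorem ord_nonneg_iff {a : K} (ha : a ≠ 0) : 0 ≤ ord K a ↔ Valued.v a ≤ (1 : ℤᵐ⁰) := by
  have ha' : Valued.v a ≠ (0 : ℤᵐ⁰) := (Valuation.ne_zero_iff _).2 ha
  rw [ord, Left.nonneg_neg_iff, ← WithZero.log_one, WithZero.log_le_log ha' one_ne_zero]

theorem min_ord_le {a b : K} (ha : a ≠ 0) (hb : b ≠ 0) (hab : a + b ≠ 0) :
    min (ord K a) (ord K b) ≤ ord K (a + b) := by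
  have ha' : Valued.v a ≠ (0 : ℤᵐ⁰) := (Valuation.ne_zero_iff _).2 ha
  have hb' : Valued.v b ≠ (0 : ℤᵐ⁰) := (Valuation.ne_zero_iff _).2 hb
  have hab' : Valued.v (a + b) ≠ (0 : ℤᵐ⁰) := (Valuation.ne_zero_iff _).2 hab
  rcases le_max_iff.1 (Valuation.map_add Valued.v a b) with h | h
  · exact (min_le_left _ _).trans (neg_le_neg ((WithZero.log_le_log hab' ha').2 h))
  · exact (min_le_right _ _).trans (neg_le_neg ((WithZero.log_le_log hab' hb').2 h))

theorem termVal_mul (r : Fin n → ℚ) {a b : K} (ha : a ≠ 0) (hb : b ≠ 0) (i j : Fin n →₀ ℕ) :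
    termVal r (a * b) (i + j) = termVal r a i + termVal r b j := by
  simp only [termVal, ord_mul ha hb, Finsupp.add_apply, Nat.cast_add, mul_add,
    Finset.sum_add_distrib, Int.cast_add]
  ring

theorem min_termVal_le (r : Fin n → ℚ) {a b : K} (ha : a ≠ 0) (hb : b ≠ 0) (hab : a + b ≠ 0)
    (i : Fin n →₀ ℕ) : min (termVal r a i) (termVal r b i) ≤ termVal r (a + b) i := by
  have h := min_ord_le ha hb hab
  simp only [termVal]
  rcases min_le_iff.1 h with h | h
  · refine (min_le_left _ _).trans ?_
    have : (ord K a : ℚ) ≤ ord K (a + b) := by exact_mod_cast h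
    linarith
  · refine (min_le_right _ _).trans ?_
    have : (ord K b : ℚ) ≤ ord K (a + b) := by exact_mod_cast h
    linarith

theorem exists_termVal_le_sum (r : Fin n → ℚ) (i : Fin n →₀ ℕ) {ι : Type*} (s : Finset ι)
    (g : ι → K) (h : ∑ x ∈ s, g x ≠ 0) :
    ∃ x ∈ s, g x ≠ 0 ∧ termVal r (g x) i ≤ termVal r (∑ x ∈ s, g x) i := by
  classical
  induction s using Finset.induction_on with
  | empty => simp at h
  | insert y s hy ih =>
    rw [Finset.sum_insert hy] at h ⊢
    by_cases h1 : g y = 0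
    · rw [h1, zero_add] at h ⊢
      obtain ⟨x, hx, hx'⟩ := ih h
      exact ⟨x, Finset.mem_insert_of_mem hx, hx'⟩
    by_cases h2 : ∑ x ∈ s, g x = 0
    · rw [h2, add_zero]
      exact ⟨y, Finset.mem_insert_self _ _, h1, le_rfl⟩
    rcases min_le_iff.1 (min_termVal_le r h1 h2 h i) with h3 | h3
    · exact ⟨y, Finset.mem_insert_self _ _, h1, h3⟩
    · obtain ⟨x, hx, hx0, hx'⟩ := ih h2
      exact ⟨x, Finset.mem_insert_of_mem hx, hx0, hx'.trans h3⟩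

theorem IsConvergent.bddBelow {r : Fin n → ℚ} {f : MvPowerSeries (Fin n) K}
    (hf : IsConvergent r f) : ∃ c : ℚ, ∀ i, MvPowerSeries.coeff i f ≠ 0 →
      c ≤ termVal r (MvPowerSeries.coeff i f) i := by
  obtain ⟨c, hc⟩ := ((hf 0).image fun i => termVal r (MvPowerSeries.coeff i f) i).bddBelow
  refine ⟨min c 0, fun i hi => ?_⟩
  by_cases h : termVal r (MvPowerSeries.coeff i f) i < 0
  · exact (min_le_left _ _).trans (hc ⟨i, ⟨hi, h⟩, rfl⟩)
  · exact (min_le_right _ _).trans (not_lt.1 h)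

theorem IsConvergent.mul {r : Fin n → ℚ} {f g : MvPowerSeries (Fin n) K}
    (hf : IsConvergent r f) (hg : IsConvergent r g) : IsConvergent r (f * g) := by
  classical
  intro C
  obtain ⟨c, hc⟩ := hf.bddBelow
  obtain ⟨d, hd⟩ := hg.bddBelow
  refine ((hf (C - d)).image2 (· + ·) (hg (C - c))).subset ?_
  rintro k ⟨hk, hkC⟩
  rw [MvPowerSeries.coeff_mul] at hk hkC
  obtain ⟨⟨i, j⟩, hij, h0, hle⟩ := exists_termVal_le_sum r k _ _ hk
  replace hij : i + j = k := Finset.HasAntidiagonal.mem_antidiagonal.1 hij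
  simp only at h0 hle
  have hi := left_ne_zero_of_mul h0
  have hj := right_ne_zero_of_mul h0
  subst hij
  rw [termVal_mul r hi hj] at hle
  have := hc i hi
  have := hd j hj
  exact ⟨i, ⟨hi, by linarith⟩, j, ⟨hj, by linarith⟩, rfl⟩

theorem IsConvergent.add {r : Fin n → ℚ} {f g : MvPowerSeries (Fin n) K}
    (hf : IsConvergent r f) (hg : IsConvergent r g) : IsConvergent r (f + g) := by
  intro C
  refine ((hf C).union (hg C)).subset ?_
  rintro k ⟨hk, hkC⟩
  rw [map_add] at hk hkC
  by_cases h1 : MvPowerSeries.coeff k f = 0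
  · right
    rw [h1, zero_add] at hk hkC
    exact ⟨hk, hkC⟩
  by_cases h2 : MvPowerSeries.coeff k g = 0
  · left
    rw [h2, add_zero] at hk hkC
    exact ⟨hk, hkC⟩
  rcases min_le_iff.1 (min_termVal_le r h1 h2 hk k) with h | h
  · exact Or.inl ⟨h1, h.trans_lt hkC⟩
  · exact Or.inr ⟨h2, h.trans_lt hkC⟩

theorem isConvergent_coe (r : Fin n → ℚ) (p : MvPolynomial (Fin n) K) :
    IsConvergent r (p : MvPowerSeries (Fin n) K) := by
  intro C
  refine p.support.finite_toSet.subset ?_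
  rintro k ⟨hk, -⟩
  rw [MvPolynomial.coeff_coe] at hk
  simpa using hk

variable (K)

/-- The Tate algebra `K{X; r}` with convergence log-radii `r`. -/
def tateAlgebra (r : Fin n → ℚ) : Subalgebra K (MvPowerSeries (Fin n) K) where
  carrier := {f | IsConvergent r f}
  mul_mem' := IsConvergent.mul
  add_mem' := IsConvergent.add
  algebraMap_mem' a := by
    have h := isConvergent_coe (K := K) r (MvPolynomial.C a)
    rw [MvPolynomial.coe_C] at h
    exact h

variable {K}

/-- A polynomial, seen in the Tate algebra. -/
def ofPolynomial (r : Fin n → ℚ) (p : MvPolynomial (Fin n) K) : tateAlgebra K r :=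
  ⟨(p : MvPowerSeries (Fin n) K), isConvergent_coe r p⟩

theorem tateAlgebra_mono {r u : Fin n → ℚ} (h : u ≤ r) : tateAlgebra K r ≤ tateAlgebra K u := by
  intro f hf C
  refine (hf C).subset ?_
  rintro i ⟨hi, hC⟩
  refine ⟨hi, lt_of_le_of_lt ?_ hC⟩
  refine sub_le_sub_left (Finset.sum_le_sum fun j _ => ?_) _
  exact mul_le_mul_of_nonneg_right (h j) (Nat.cast_nonneg _)

/-- The ideal `I·K{X; u}` of `K{X; u}` generated by an ideal `I` of `K{X; r}`, for `u ≤ r`. -/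
def extendIdeal {r u : Fin n → ℚ} (h : u ≤ r) (I : Ideal (tateAlgebra K r)) :
    Ideal (tateAlgebra K u) :=
  I.map (Subalgebra.inclusion (tateAlgebra_mono h))

/-- The Gauss valuation of a series: the minimum of the Gauss valuations of its (nonzero)
terms, `+∞` for the zero series. -/
def gaussVal (r : Fin n → ℚ) (f : tateAlgebra K r) : EReal :=
  ⨅ (i : Fin n →₀ ℕ) (_ : MvPowerSeries.coeff i f.1 ≠ 0),
    (((termVal r (MvPowerSeries.coeff i f.1) i : ℚ) : ℝ) : EReal)

/-- The quotient (semi-)norm on `K{X; r} / J`, written additively: the supremum of the Gauss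
valuations of the lifts. -/
def quotVal {r : Fin n → ℚ} (J : Ideal (tateAlgebra K r)) (x : tateAlgebra K r ⧸ J) : EReal :=
  ⨆ (f : tateAlgebra K r) (_ : Ideal.Quotient.mk J f = x), gaussVal r f

theorem lt_quotVal_iff {r : Fin n → ℚ} {J : Ideal (tateAlgebra K r)} {x : tateAlgebra K r ⧸ J}
    {c : EReal} : c < quotVal J x ↔ ∃ f, Ideal.Quotient.mk J f = x ∧ c < gaussVal r f := by
  simp only [quotVal, lt_iSup_iff, exists_prop]

theorem gaussVal_add (r : Fin n → ℚ) (f g : tateAlgebra K r) :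
    min (gaussVal r f) (gaussVal r g) ≤ gaussVal r (f + g) := by
  refine le_iInf₂ fun i hi => ?_
  have hadd : MvPowerSeries.coeff i (f + g).1
      = MvPowerSeries.coeff i f.1 + MvPowerSeries.coeff i g.1 := map_add _ _ _
  rw [hadd] at hi ⊢
  by_cases h1 : MvPowerSeries.coeff i f.1 = 0
  · rw [h1, zero_add] at hi ⊢
    exact (min_le_right _ _).trans (iInf₂_le i hi)
  by_cases h2 : MvPowerSeries.coeff i g.1 = 0
  · rw [h2, add_zero] at hi ⊢
    exact (min_le_left _ _).trans (iInf₂_le i hi)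
  rcases min_le_iff.1 (min_termVal_le r h1 h2 hi i) with h | h
  · refine (min_le_left _ _).trans ((iInf₂_le i h1).trans ?_)
    exact_mod_cast h
  · refine (min_le_right _ _).trans ((iInf₂_le i h2).trans ?_)
    exact_mod_cast h

theorem gaussVal_smul (r : Fin n → ℚ) (a : 𝒪[K]) (f : tateAlgebra K r) :
    gaussVal r f ≤ gaussVal r (a • f) := by
  refine le_iInf₂ fun i hi => ?_
  have hmul : MvPowerSeries.coeff i (a • f).1 = (a : K) * MvPowerSeries.coeff i f.1 := rfl
  rw [hmul] at hi ⊢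
  have ha := left_ne_zero_of_mul hi
  have hf := right_ne_zero_of_mul hi
  refine (iInf₂_le i hf).trans ?_
  have h0 : 0 ≤ ord K (a : K) := (ord_nonneg_iff ha).2 a.2
  have : termVal r (MvPowerSeries.coeff i f.1) i
      ≤ termVal r ((a : K) * MvPowerSeries.coeff i f.1) i := by
    have h1 : (0 : ℚ) ≤ ord K (a : K) := by exact_mod_cast h0
    simp only [termVal, ord_mul ha hf, Int.cast_add]
    linarith
  exact_mod_cast this

/-- The unit ball of `K{X; r} / J` for the quotient norm, as a module over `K° = 𝒪[K]`. -/
def unitBall {r : Fin n → ℚ} (J : Ideal (tateAlgebra K r)) :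
    Submodule 𝒪[K] (tateAlgebra K r ⧸ J) where
  carrier := {x | 0 ≤ quotVal J x}
  zero_mem' := by
    refine le_trans ?_ (le_iSup₂ (f := fun f (_ : Ideal.Quotient.mk J f = 0) => gaussVal r f)
      0 (map_zero _))
    exact le_iInf₂ fun i hi => absurd (map_zero _) hi
  add_mem' {x y} hx hy := by
    have hx' : 0 ≤ quotVal J x := hx
    have hy' : 0 ≤ quotVal J y := hy
    change 0 ≤ quotVal J (x + y)
    refine le_of_forall_lt fun c hc => ?_
    obtain ⟨f, hf, hfc⟩ := lt_quotVal_iff.1 (lt_of_lt_of_le hc hx')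
    obtain ⟨g, hg, hgc⟩ := lt_quotVal_iff.1 (lt_of_lt_of_le hc hy')
    exact lt_quotVal_iff.2 ⟨f + g, by rw [map_add, hf, hg],
      lt_of_lt_of_le (lt_min hfc hgc) (gaussVal_add r f g)⟩
  smul_mem' a x hx := by
    have hx' : 0 ≤ quotVal J x := hx
    change 0 ≤ quotVal J (a • x)
    refine le_of_forall_lt fun c hc => ?_
    obtain ⟨f, hf, hfc⟩ := lt_quotVal_iff.1 (lt_of_lt_of_le hc hx')
    exact lt_quotVal_iff.2 ⟨a • f, by rw [← hf]; rfl,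
      lt_of_lt_of_le hfc (gaussVal_smul r a f)⟩

/-- The strict order on nonzero terms: `a X^i < b X^j` if the Gauss valuation of `a X^i` is
larger, or if the Gauss valuations agree and `X^i < X^j` for the monomial order. -/
def TermLT (r : Fin n → ℚ) (m : MonomialOrder (Fin n)) (a : K) (i : Fin n →₀ ℕ)
    (b : K) (j : Fin n →₀ ℕ) : Prop :=
  termVal r b j < termVal r a i ∨ (termVal r a i = termVal r b j ∧ m.toSyn i < m.toSyn j)

/-- `X^i` is the monomial of the leading term, i.e. of the maximal term, of `f`. -/
def IsLeadingMonomial {r : Fin n → ℚ} (m : MonomialOrder (Fin n)) (f : tateAlgebra K r)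
    (i : Fin n →₀ ℕ) : Prop :=
  MvPowerSeries.coeff i f.1 ≠ 0 ∧
    ∀ j, MvPowerSeries.coeff j f.1 ≠ 0 → j ≠ i →
      TermLT r m (MvPowerSeries.coeff j f.1) j (MvPowerSeries.coeff i f.1) i

/-- `G` is a Gröbner basis of `J`: a finite family of elements of `J` such that the leading term
of every nonzero element of `J` is divisible by the leading term of a member of `G` (nonzero
coefficients are invertible, so divisibility of terms is divisibility of monomials). -/
def IsGroebnerBasis {r : Fin n → ℚ} (m : MonomialOrder (Fin n)) (J : Ideal (tateAlgebra K r))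
    (G : List (tateAlgebra K r)) : Prop :=
  (∀ g ∈ G, g ∈ J) ∧
    ∀ f ∈ J, f ≠ 0 → ∃ g ∈ G, ∃ i j, IsLeadingMonomial m g i ∧ IsLeadingMonomial m f j ∧ i ≤ j

end Tate

/-! ## Computations with a count of arithmetic operations -/

/-- The result of a computation together with the number of arithmetic operations performed. -/
structure Counted (α : Type*) where
  /-- the result -/
  val : α
  /-- the number of arithmetic operations -/
  ops : ℕ

namespace Counted

/-- A result that is available without arithmetic operation. -/
def pure {α : Type*} (a : α) : Counted α := ⟨a, 0⟩

/-- Sequential composition; the operation counts add up. -/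
def bind {α β : Type*} (x : Counted α) (f : α → Counted β) : Counted β :=
  ⟨(f x.val).val, x.ops + (f x.val).ops⟩

/-- Computes the entries of a vector one after the other. -/
def vec {α : Type*} {d : ℕ} (f : Fin d → Counted α) : Counted (Fin d → α) :=
  ⟨fun i => (f i).val, ∑ i, (f i).ops⟩

/-- A loop over a list. -/
def loop {α β : Type*} (f : β → α → Counted β) : β → List α → Counted β
  | b, [] => pure b
  | b, a :: l => (f b a).bind fun b' => loop f b' l

/-- Applies a computation to the members of a list. -/
def mapList {α β : Type*} (f : α → Counted β) : List α → Counted (List β)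
  | [] => pure []
  | a :: l => (f a).bind fun b => (mapList f l).bind fun bs => pure (b :: bs)

end Counted

/-- The scalar operations available to an algorithm. The algorithms below are written for a bare
type `S` of scalars, so that scalars can be produced and inspected only through these
(counted) operations. -/
structure Arith (S : Type*) where
  zero : S
  one : S
  add : S → S → Counted S
  sub : S → S → Counted S
  mul : S → S → Counted S
  div : S → S → Counted S
  isZero : S → Counted Bool

open Classical in
/-- The operations of a field; each of them costs `1`. -/
def Arith.ofField (F : Type*) [Field F] : Arith F where
  zero := 0
  one := 1
  add a b := ⟨a + b, 1⟩
  sub a b := ⟨a - b, 1⟩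
  mul a b := ⟨a * b, 1⟩
  div a b := ⟨a / b, 1⟩
  isZero a := ⟨decide (a = 0), 1⟩

/-- The scalar operations available to an algorithm over a local ring with elements `O`, with
fraction field `S` and with residue field `s`. -/
structure LocalArith (O S s : Type*) where
  frac : Arith S
  residueField : Arith s
  incl : O → Counted S
  residue : O → Counted s

/-- The operations of `K°`, `K` and the residue field; each of them costs `1`. -/
def LocalArith.ofValued (K : Type*) [Field K] [Valued K ℤᵐ⁰] : LocalArith 𝒪[K] K 𝓀[K] where
  frac := Arith.ofField K
  residueField := Arith.ofField 𝓀[K]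
  incl a := ⟨(a : K), 1⟩
  residue a := ⟨IsLocalRing.residue 𝒪[K] a, 1⟩

/-! ## Linear algebra -/

section LinearAlgebra

variable {S : Type*} {d : ℕ}

/-- The product of a matrix and a vector. -/
def matVec (o : Arith S) (A : Fin d → Fin d → S) (v : Fin d → S) : Counted (Fin d → S) :=
  Counted.vec fun i =>
    Counted.loop (fun s j => (o.mul (A i j) (v j)).bind fun t => o.add s t) o.zero (List.finRange d)

/-- `v - a w`. -/
def subMul (o : Arith S) (v : Fin d → S) (a : S) (w : Fin d → S) : Counted (Fin d → S) :=
  Counted.vec fun i => (o.mul a (w i)).bind fun t => o.sub (v i) t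

/-- `v / a`. -/
def divVec (o : Arith S) (v : Fin d → S) (a : S) : Counted (Fin d → S) :=
  Counted.vec fun i => o.div (v i) a

/-- A row of an echelon form of a family `b₀, b₁, …` of vectors: the vector
`vec = ∑ j, comb j • b_j`, whose entry at `pivot` is `1`. -/
structure Row (S : Type*) (d : ℕ) where
  pivot : Fin d
  vec : Fin d → S
  comb : Fin d → S

/-- Reduces `v` by the rows. The result `(v', c)` satisfies `v' = v + ∑ j, c j • b_j`. -/
def reduce (o : Arith S) (rows : List (Row S d)) (v : Fin d → S) :
    Counted ((Fin d → S) × (Fin d → S)) :=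
  Counted.loop
    (fun p row =>
      (subMul o p.1 (p.1 row.pivot) row.vec).bind fun v' =>
        (subMul o p.2 (p.1 row.pivot) row.comb).bind fun c' => Counted.pure (v', c'))
    (v, fun _ => o.zero) rows

/-- The first index in the list at which `v` does not vanish. -/
def findPivot (o : Arith S) (v : Fin d → S) : List (Fin d) → Counted (Option (Fin d))
  | [] => Counted.pure none
  | i :: l => (o.isZero (v i)).bind fun z => if z then findPivot o v l else Counted.pure (some i)

/-- Tests whether `v` depends linearly on the family `b₀, …, b_{k-1}` whose echelon form is given.
If so, returns coefficients `c` with `v + ∑ j, c j • b_j = 0`; otherwise, returns the echelon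
form of the family extended by `b_k = v`. -/
def insertVec (o : Arith S) (rows : List (Row S d)) (v : Fin d → S) :
    Counted ((Fin d → S) ⊕ List (Row S d)) :=
  (reduce o rows v).bind fun p =>
    (findPivot o p.1 (List.finRange d)).bind fun piv =>
      match piv with
      | none => Counted.pure (Sum.inl p.2)
      | some i =>
        (divVec o p.1 (p.1 i)).bind fun v' =>
          (divVec o (fun j => if j.val = rows.length then o.one else p.2 j) (p.1 i)).bind fun c' =>
            Counted.pure (Sum.inr (rows ++ [⟨i, v', c'⟩]))

/-- The echelon form of a family of linearly independent vectors. -/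
def echelon (o : Arith S) (b : List (Fin d → S)) : Counted (List (Row S d)) :=
  Counted.loop
    (fun rows v => (insertVec o rows v).bind fun res =>
      match res with
      | Sum.inl _ => Counted.pure rows
      | Sum.inr rows' => Counted.pure rows')
    [] b

end LinearAlgebra

/-! ## The algorithms -/

/-- A monic polynomial `X^lead + ∑ c X^μ`, the sum running over the entries `(μ, c)` of `tail`. -/
structure MonicPoly (S : Type*) (n : ℕ) where
  lead : Fin n →₀ ℕ
  tail : List ((Fin n →₀ ℕ) × S)

/-- The polynomial that is represented. -/
def MonicPoly.toMvPolynomial {F : Type*} [Field F] {n : ℕ} (g : MonicPoly F n) :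
    MvPolynomial (Fin n) F :=
  MvPolynomial.monomial g.lead 1 + (g.tail.map fun t => MvPolynomial.monomial t.1 t.2).sum

/-- `X^m + ∑ j, c j • X^(B j)`. -/
def MonicPoly.mk' {S : Type*} {n d : ℕ} (m : Fin n →₀ ℕ) (B : List (Fin n →₀ ℕ)) (c : Fin d → S) :
    MonicPoly S n :=
  ⟨m, B.zip (List.ofFn c)⟩

section Algorithms

variable {S : Type*} {n d : ℕ}

/-- Writes `μ = X_i μ'` with a monomial `μ'` in the table, and returns `i` and the vector stored
with `μ'`. -/
def splitMonomial (T : List ((Fin n →₀ ℕ) × (Fin d → S))) (μ : Fin n →₀ ℕ) :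
    Option (Fin n × (Fin d → S)) :=
  (List.finRange n).findSome? fun i =>
    (T.find? fun p => decide (p.1 + Finsupp.single i 1 = μ)).map fun p => (i, p.2)

/-- The coordinates of the monomial `μ`, given a table of coordinates of smaller monomials: the
product `U_i v` if `μ = X_i μ'` where `μ'` is in the table with coordinates `v`, and `w`
if there is no such decomposition (which is the case `μ = 1`). -/
def monomialVec (o : Arith S) (U : Fin n → Fin d → Fin d → S) (w : Fin d → S)
    (T : List ((Fin n →₀ ℕ) × (Fin d → S))) (μ : Fin n →₀ ℕ) : Counted (Fin d → S) :=
  match splitMonomial T μ with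
  | some (i, v) => matVec o (U i) v
  | none => Counted.pure w

/-- The state of the classical FGLM algorithm. -/
structure FGLMState (S : Type*) (n d : ℕ) where
  /-- the monomials that remain to be considered -/
  todo : List (Fin n →₀ ℕ)
  /-- the monomials of the staircase found so far, in increasing order, with their coordinates -/
  stairs : List ((Fin n →₀ ℕ) × (Fin d → S))
  /-- the echelon form of these coordinates -/
  rows : List (Row S d)
  /-- the elements of the Gröbner basis found so far -/
  basis : List (MonicPoly S n)

/-- One step of the classical FGLM algorithm: considers the smallest remaining monomial `μ`. If
`μ` is not a multiple of a leading monomial found so far, its coordinates are computed; if they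
depend linearly on those of the staircase, this gives an element of the Gröbner basis, and
otherwise `μ` joins the staircase and the monomials `X_i μ` remain to be considered. -/
def fglmStep (m : MonomialOrder (Fin n)) (o : Arith S) (U : Fin n → Fin d → Fin d → S)
    (w : Fin d → S) (st : FGLMState S n d) : Counted (FGLMState S n d) :=
  match st.todo.argmin m.toSyn with
  | none => Counted.pure st
  | some μ =>
    let rest := st.todo.filter fun ν => decide (ν ≠ μ)
    if st.basis.any fun g => decide (g.lead ≤ μ) then
      Counted.pure { st with todo := rest }
    else
      (monomialVec o U w st.stairs μ).bind fun v =>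
        (insertVec o st.rows v).bind fun res =>
          match res with
          | Sum.inl c =>
            Counted.pure
              { st with
                todo := rest
                basis := st.basis ++ [MonicPoly.mk' μ (st.stairs.map Prod.fst) c] }
          | Sum.inr rows' =>
            Counted.pure
              { st with
                todo := rest ++ (List.finRange n).map fun i => μ + Finsupp.single i 1
                stairs := st.stairs ++ [(μ, v)]
                rows := rows' }

/-- The classical FGLM algorithm over a field, for the multiplication matrices `U i` (with columns
the images of the basis vectors: `U i a b` is the entry in row `a` and column `b`) and the
vector `w` of the monomial `1`. At most `n d + 1` monomials are ever considered. Returns the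
Gröbner basis, and the staircase in increasing order. -/
def fglmField (m : MonomialOrder (Fin n)) (o : Arith S) (U : Fin n → Fin d → Fin d → S)
    (w : Fin d → S) : Counted (List (MonicPoly S n) × List (Fin n →₀ ℕ)) :=
  (Counted.loop (fun st (_ : ℕ) => fglmStep m o U w st) ⟨[0], [], [], []⟩
    (List.range (n * d + 1))).bind fun st =>
      Counted.pure (st.basis, st.stairs.map Prod.fst)

/-- The columns of the matrix `M`: the coordinates of the monomials of `B`, in the given order. -/
def monomialTable (o : Arith S) (U : Fin n → Fin d → Fin d → S) (w : Fin d → S)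
    (B : List (Fin n →₀ ℕ)) : Counted (List ((Fin n →₀ ℕ) × (Fin d → S))) :=
  Counted.loop
    (fun T μ => (monomialVec o U w T μ).bind fun v => Counted.pure (T ++ [(μ, v)])) [] B

/-- The reconstruction algorithm `GB` for the log-radii `u = 0`. From the multiplication matrices
and the vector of `1`, with entries in `K°`: runs the classical FGLM algorithm over the residue
field, computes the coordinates `M` of the monomials of the staircase `B` and `N` of the leading
monomials, solves `M Q = N` by elimination, and returns the polynomials
`X^m - ∑ μ ∈ B, Q_{μ, m} X^μ`. (The elimination returns the coefficients `-Q_{μ, m}`.) -/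
def algorithmGB {O S s : Type*} {n d : ℕ} (A : LocalArith O S s) (m : MonomialOrder (Fin n))
    (U : Fin n → Fin d → Fin d → O) (w : Fin d → O) : Counted (List (MonicPoly S n)) :=
  (Counted.vec fun i => Counted.vec fun a => Counted.vec fun b => A.residue (U i a b)).bind
    fun Ubar =>
  (Counted.vec fun a => A.residue (w a)).bind fun wbar =>
  (fglmField m A.residueField Ubar wbar).bind fun GB =>
  (Counted.vec fun i => Counted.vec fun a => Counted.vec fun b => A.incl (U i a b)).bind fun UK =>
  (Counted.vec fun a => A.incl (w a)).bind fun wK =>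
  (monomialTable A.frac UK wK GB.2).bind fun M =>
  (echelon A.frac (M.map Prod.snd)).bind fun rows =>
  Counted.mapList
    (fun g => (monomialVec A.frac UK wK M g.lead).bind fun v =>
      (reduce A.frac rows v).bind fun p =>
        Counted.pure (MonicPoly.mk' g.lead GB.2 p.2))
    GB.1

end Algorithms

end TateFGLM

end

open TateFGLM

/-! Everything is carried by the reduction modulo `π` of the coordinates of monomials. A nonzero
series has a coefficient of maximal absolute value, and the valuation is discrete, so `D` is exactly
the image of the series with integral coefficients (`IsInt.mk_mem`, `exists_isInt_of_mem`). Modulo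
`π` such a series is a polynomial, since all but finitely many of its coefficients lie in the
maximal ideal. Hence the reduced coordinates of its class are a finite combination of those of the
monomials (`redCoord_eq_sum`), and the latter span the residue space (`span_redCoord_eq_top`).

FGLM over the residue field therefore finds a staircase `B` of exactly `δ` monomials whose reduced
coordinates form a basis, and each new leading monomial depends, modulo `π`, only on smaller members
of `B` (`fglmField_spec`, `FGLMSpec.exists_basis`). The determinant of `M` is then a unit of `K°`,
so the solution over `K` is integral and reduces to the residual relation
(`exists_integral_relation`). In an output polynomial, the tail coefficients at monomials not
smaller than `m` are thus divisible by `π`, and `m` is the leading monomial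
(`isLeadingMonomial_mk'`). The relation holds in `D`, so the polynomial lies in `J`.

Conversely, let `f` in `J` be nonzero, scaled so that its largest coefficients are units. Its
reduction is a relation between reduced coordinates of monomials, and its largest monomial is the
leading monomial of `f`. That monomial is outside `B`, by independence of the staircase, hence is a
multiple of some `g.lead` (`FGLMSpec.exists_lead_le`).

For the cost, every step of FGLM removes a candidate and only the at most `δ` staircase members
create new ones, `n` each. So `nδ + 1` steps suffice, each of quadratic cost; the lift to `K`
inserts at most `δ` vectors and reduces at most `nδ + 1` more. -/

noncomputable section

namespace TateFGLM

/-! ## Counted computations -/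

namespace Counted

variable {α β : Type*}

@[simp] theorem val_pure (a : α) : (pure a).val = a := rfl

@[simp] theorem ops_pure (a : α) : (pure a).ops = 0 := rfl

@[simp] theorem val_bind (x : Counted α) (f : α → Counted β) :
    (x.bind f).val = (f x.val).val := rfl

@[simp] theorem ops_bind (x : Counted α) (f : α → Counted β) :
    (x.bind f).ops = x.ops + (f x.val).ops := rfl

theorem ops_vec_le {d c : ℕ} {f : Fin d → Counted α} (h : ∀ i, (f i).ops ≤ c) :
    (vec f).ops ≤ d * c :=
  (Finset.sum_le_card_nsmul Finset.univ _ c fun i _ => h i).trans (by simp)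

@[simp] theorem loop_nil (f : β → α → Counted β) (b : β) : loop f b [] = pure b := rfl

@[simp] theorem val_loop_cons (f : β → α → Counted β) (b : β) (a : α) (l : List α) :
    (loop f b (a :: l)).val = (loop f (f b a).val l).val := rfl

theorem ops_loop_cons (f : β → α → Counted β) (b : β) (a : α) (l : List α) :
    (loop f b (a :: l)).ops = (f b a).ops + (loop f (f b a).val l).ops := rfl

theorem val_loop (f : β → α → Counted β) (b : β) (l : List α) :
    (loop f b l).val = l.foldl (fun b a => (f b a).val) b := by
  induction l generalizing b with
  | nil => rfl
  | cons a l ih => simp [ih]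

/-- A loop whose iterations preserve an invariant, depending on the number of iterations, and cost
at most `c` operations each. -/
theorem loop_invariant {f : β → α → Counted β} (P : ℕ → β → Prop) {c : ℕ} (l : List α)
    (h : ∀ k b, ∀ a ∈ l, P k b → P (k + 1) (f b a).val ∧ (f b a).ops ≤ c) {k : ℕ} {b : β}
    (hb : P k b) : P (k + l.length) (loop f b l).val ∧ (loop f b l).ops ≤ l.length * c := by
  induction l generalizing k b with
  | nil => simpa using hb
  | cons a l ih =>
    obtain ⟨h1, h2⟩ := h k b a (List.mem_cons_self) hb
    obtain ⟨h3, h4⟩ := ih (fun k b a' ha' => h k b a' (List.mem_cons_of_mem _ ha')) h1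
    refine ⟨?_, ?_⟩
    · rw [val_loop_cons, List.length_cons, ← add_assoc, add_right_comm]
      exact h3
    · rw [ops_loop_cons, List.length_cons, add_mul, one_mul]
      omega

theorem ops_loop_le {f : β → α → Counted β} {c : ℕ} (l : List α)
    (h : ∀ b a, (f b a).ops ≤ c) (b : β) : (loop f b l).ops ≤ l.length * c :=
  (loop_invariant (fun _ _ => True) l (fun _ b a _ _ => ⟨trivial, h b a⟩) (k := 0) trivial).2

theorem val_mapList (f : α → Counted β) (l : List α) :
    (mapList f l).val = l.map fun a => (f a).val := by
  induction l with
  | nil => rfl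
  | cons a l ih => simp [mapList, ih]

theorem ops_mapList_le {f : α → Counted β} {c : ℕ} (h : ∀ a, (f a).ops ≤ c) (l : List α) :
    (mapList f l).ops ≤ l.length * c := by
  induction l with
  | nil => simp [mapList]
  | cons a l ih =>
    have := h a
    simp only [mapList, ops_bind, ops_pure, List.length_cons, add_mul]
    omega

end Counted

/-! ## Linear algebra -/

section LinearAlgebra

open Counted

variable {F : Type*} [Field F] {d : ℕ}

theorem val_matVec (A : Fin d → Fin d → F) (v : Fin d → F) :
    (matVec (Arith.ofField F) A v).val = fun i => ∑ j, A i j * v j := by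
  funext i
  have key : ∀ (l : List (Fin d)) (s : F), (loop (fun s j =>
      ((Arith.ofField F).mul (A i j) (v j)).bind fun t => (Arith.ofField F).add s t) s l).val
      = s + (l.map fun j => A i j * v j).sum := by
    intro l
    induction l with
    | nil => simp
    | cons a l ih =>
      intro s
      rw [val_loop_cons, ih, List.map_cons, List.sum_cons, ← add_assoc]
      rfl
  refine (key _ _).trans ?_
  rw [show (Arith.ofField F).zero = 0 from rfl, zero_add, ← List.ofFn_eq_map, List.sum_ofFn]

theorem ops_matVec_le (A : Fin d → Fin d → F) (v : Fin d → F) :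
    (matVec (Arith.ofField F) A v).ops ≤ d * (d * 2) := by
  refine ops_vec_le fun i => ?_
  refine (ops_loop_le (c := 2) (List.finRange d) (fun b a => le_rfl) _).trans ?_
  rw [List.length_finRange]

@[simp] theorem val_subMul (v : Fin d → F) (a : F) (w : Fin d → F) :
    (subMul (Arith.ofField F) v a w).val = v - a • w := rfl

theorem ops_subMul_le (v : Fin d → F) (a : F) (w : Fin d → F) :
    (subMul (Arith.ofField F) v a w).ops ≤ d * 2 :=
  ops_vec_le fun _ => le_rfl

@[simp] theorem val_divVec (v : Fin d → F) (a : F) :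
    (divVec (Arith.ofField F) v a).val = a⁻¹ • v := by
  funext i
  exact (div_eq_inv_mul _ _)

theorem ops_divVec_le (v : Fin d → F) (a : F) :
    (divVec (Arith.ofField F) v a).ops ≤ d * 1 :=
  ops_vec_le fun _ => le_rfl

theorem ops_reduce_le (rows : List (Row F d)) (v : Fin d → F) :
    (reduce (Arith.ofField F) rows v).ops ≤ rows.length * (d * 4) := by
  refine ops_loop_le _ (fun p row => ?_) _
  have h1 := ops_subMul_le p.1 (p.1 row.pivot) row.vec
  have h2 := ops_subMul_le p.2 (p.1 row.pivot) row.comb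
  simp only [ops_bind, ops_pure]
  omega

/-- The linear combination of a list of vectors with the given coefficients. -/
def famSum (bs : List (Fin d → F)) (c : Fin d → F) : Fin d → F :=
  ∑ j : Fin d, c j • bs.getD j 0

theorem famSum_zero (bs : List (Fin d → F)) : famSum bs 0 = 0 := by
  simp [famSum]

theorem famSum_sub_smul (bs : List (Fin d → F)) (c e : Fin d → F) (a : F) :
    famSum bs (c - a • e) = famSum bs c - a • famSum bs e := by
  simp only [famSum, Pi.sub_apply, Pi.smul_apply, sub_smul, Finset.sum_sub_distrib,
    Finset.smul_sum, smul_assoc]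

theorem famSum_smul (bs : List (Fin d → F)) (c : Fin d → F) (a : F) :
    famSum bs (a • c) = a • famSum bs c := by
  simp only [famSum, Pi.smul_apply, Finset.smul_sum, smul_assoc]

theorem famSum_mem_span (bs : List (Fin d → F)) (c : Fin d → F) :
    famSum bs c ∈ Submodule.span F {b | b ∈ bs} := by
  refine Submodule.sum_mem _ fun j _ => Submodule.smul_mem _ _ ?_
  rw [List.getD_eq_getElem?_getD]
  by_cases h : j.val < bs.length
  · rw [List.getElem?_eq_getElem h]
    exact Submodule.subset_span (List.getElem_mem h)
  · rw [List.getElem?_eq_none (not_lt.1 h)]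
    exact Submodule.zero_mem _

/-- Coefficient vectors always have `d` entries, and those beyond the length of the family multiply
the default vector `0`. They would become visible when the family grows, so they must vanish;
`IsEchelon.comb_eq_zero` records this. -/
theorem famSum_append {bs : List (Fin d → F)} {c : Fin d → F}
    (hc : ∀ j : Fin d, bs.length ≤ j.val → c j = 0) (v : Fin d → F) :
    famSum (bs ++ [v]) c = famSum bs c := by
  refine Finset.sum_congr rfl fun j _ => ?_
  by_cases h : j.val < bs.length
  · simp only [List.getD_eq_getElem?_getD, List.getElem?_append_left h]
  · rw [hc j (not_lt.1 h), zero_smul, zero_smul]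

/-- `rows` is an echelon form of the family `bs`. -/
structure IsEchelon (bs : List (Fin d → F)) (rows : List (Row F d)) : Prop where
  length_eq : rows.length = bs.length
  vec_pivot : ∀ r ∈ rows, r.vec r.pivot = 1
  vec_eq : ∀ r ∈ rows, r.vec = famSum bs r.comb
  comb_eq_zero : ∀ r ∈ rows, ∀ j : Fin d, bs.length ≤ j.val → r.comb j = 0
  pairwise : rows.Pairwise fun r s => s.vec r.pivot = 0

theorem IsEchelon.nil : IsEchelon ([] : List (Fin d → F)) [] := by
  constructor <;> simp

theorem IsEchelon.nodup_pivot {bs : List (Fin d → F)} {rows : List (Row F d)}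
    (h : IsEchelon bs rows) : (rows.map Row.pivot).Nodup := by
  rw [List.Nodup, List.pairwise_map]
  refine h.pairwise.imp_of_mem ?_
  intro r s _ hs hrs heq
  rw [heq, h.vec_pivot s hs] at hrs
  exact one_ne_zero hrs

theorem IsEchelon.length_le {bs : List (Fin d → F)} {rows : List (Row F d)}
    (h : IsEchelon bs rows) : rows.length ≤ d := by
  simpa using h.nodup_pivot.length_le_card

theorem reduce_comb {bs : List (Fin d → F)} (rows : List (Row F d))
    (h1 : ∀ r ∈ rows, r.vec = famSum bs r.comb)
    (h2 : ∀ r ∈ rows, ∀ j : Fin d, bs.length ≤ j.val → r.comb j = 0) (v : Fin d → F) :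
    (reduce (Arith.ofField F) rows v).val.1 =
        v + famSum bs (reduce (Arith.ofField F) rows v).val.2 ∧
      ∀ j : Fin d, bs.length ≤ j.val → (reduce (Arith.ofField F) rows v).val.2 j = 0 := by
  -- Only the invariant is used here; the cost bound need only be large enough for one iteration.
  refine (loop_invariant (c := rows.length * (d * 4) + d * 4)
    (fun _ (p : (Fin d → F) × (Fin d → F)) => p.1 = v + famSum bs p.2 ∧
      ∀ j : Fin d, bs.length ≤ j.val → p.2 j = 0) rows ?_ (k := 0) ?_).1
  · rintro - p r hr ⟨hp1, hp2⟩
    refine ⟨⟨?_, ?_⟩, ?_⟩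
    · simp only [val_bind, val_subMul, val_pure]
      rw [famSum_sub_smul, h1 r hr, hp1]
      abel
    · intro j hj
      simp [hp2 j hj, h2 r hr j hj]
    · have h1 := ops_subMul_le p.1 (p.1 r.pivot) r.vec
      have h2 := ops_subMul_le p.2 (p.1 r.pivot) r.comb
      simp only [ops_bind, ops_pure]
      omega
  · refine ⟨?_, fun _ _ => rfl⟩
    have : (fun _ : Fin d => (Arith.ofField F).zero) = 0 := rfl
    rw [this, famSum_zero, add_zero]

/-- Later rows vanish at earlier pivots, so an entry that has been cleared stays cleared. The
induction follows one coordinate `q`: either it is already cleared and untouched by the remaining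
rows, or it is still the pivot of one of them. -/
theorem reduce_pivot (rows : List (Row F d)) (h1 : ∀ r ∈ rows, r.vec r.pivot = 1)
    (h2 : rows.Pairwise fun r s => s.vec r.pivot = 0) (v : Fin d → F) :
    ∀ r ∈ rows, (reduce (Arith.ofField F) rows v).val.1 r.pivot = 0 := by
  suffices H : ∀ p : (Fin d → F) × (Fin d → F), ∀ q,
      (p.1 q = 0 ∧ ∀ s ∈ rows, s.vec q = 0) ∨ (∃ r ∈ rows, r.pivot = q) →
      (loop (fun (p : (Fin d → F) × (Fin d → F)) (row : Row F d) =>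
      (subMul (Arith.ofField F) p.1 (p.1 row.pivot) row.vec).bind fun v' =>
        (subMul (Arith.ofField F) p.2 (p.1 row.pivot) row.comb).bind fun c' =>
          Counted.pure (v', c')) p rows).val.1 q = 0 from
    fun r hr => H _ _ (Or.inr ⟨r, hr, rfl⟩)
  induction rows with
  | nil =>
    rintro p q (h | ⟨r, hr, -⟩)
    · exact h.1
    · simp at hr
  | cons s rows ih =>
    rw [List.pairwise_cons] at h2
    intro p q hq
    rw [val_loop_cons]
    refine ih (fun r hr => h1 r (List.mem_cons_of_mem _ hr)) h2.2 _ _ ?_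
    simp only [val_bind, val_subMul, val_pure]
    rcases hq with ⟨hq, hs⟩ | ⟨r, hr, rfl⟩
    · left
      refine ⟨?_, fun t ht => hs t (List.mem_cons_of_mem _ ht)⟩
      simp [hq, hs s List.mem_cons_self]
    · rcases List.mem_cons.1 hr with rfl | hr
      · left
        refine ⟨?_, h2.1⟩
        simp [h1 r List.mem_cons_self]
      · exact Or.inr ⟨r, hr, rfl⟩

theorem findPivot_none (v : Fin d → F) (l : List (Fin d))
    (h : (findPivot (Arith.ofField F) v l).val = none) : ∀ i ∈ l, v i = 0 := by
  induction l with
  | nil => simp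
  | cons a l ih =>
    by_cases ha : v a = 0
    · simp only [findPivot, Arith.ofField, val_bind, ha, decide_true, if_true] at h
      simpa [ha] using ih h
    · simp [findPivot, Arith.ofField, ha] at h

theorem findPivot_some (v : Fin d → F) (l : List (Fin d)) {i : Fin d}
    (h : (findPivot (Arith.ofField F) v l).val = some i) : v i ≠ 0 := by
  induction l with
  | nil => simp [findPivot] at h
  | cons a l ih =>
    by_cases ha : v a = 0
    · simp only [findPivot, Arith.ofField, val_bind, ha, decide_true, if_true] at h
      exact ih h
    · simp only [findPivot, Arith.ofField, val_bind, ha, decide_false, Bool.false_eq_true,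
        if_false, val_pure, Option.some.injEq] at h
      exact h ▸ ha

theorem ops_findPivot_le (v : Fin d → F) (l : List (Fin d)) :
    (findPivot (Arith.ofField F) v l).ops ≤ l.length := by
  induction l with
  | nil => simp [findPivot]
  | cons a l ih =>
    by_cases ha : v a = 0
    · simp only [findPivot, Arith.ofField, ops_bind, ha, decide_true, if_true, List.length_cons]
      have : _ ≤ _ := ih
      simp only [Arith.ofField] at this
      omega
    · simp [findPivot, Arith.ofField, ha]

/-- Reduction costs at most `4d²`, the pivot search `d`, and the two normalizations `d` each. -/
theorem ops_insertVec_le {rows : List (Row F d)} (hr : rows.length ≤ d) (v : Fin d → F) :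
    (insertVec (Arith.ofField F) rows v).ops ≤ 7 * d ^ 2 := by
  have h1 := ops_reduce_le rows v
  have h2 : rows.length * (d * 4) ≤ d * (d * 4) := Nat.mul_le_mul_right _ hr
  have h3 := ops_findPivot_le (reduce (Arith.ofField F) rows v).val.1 (List.finRange d)
  rw [List.length_finRange] at h3
  have hd : d ≤ d ^ 2 := Nat.le_self_pow two_ne_zero d
  simp only [insertVec, ops_bind]
  split
  · simp only [ops_pure]
    nlinarith
  · rename_i i _
    simp only [ops_bind, ops_pure]
    have h4 := ops_divVec_le (reduce (Arith.ofField F) rows v).val.1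
      ((reduce (Arith.ofField F) rows v).val.1 i)
    have h5 := ops_divVec_le (fun j : Fin d => if j.val = rows.length then (Arith.ofField F).one
      else (reduce (Arith.ofField F) rows v).val.2 j) ((reduce (Arith.ofField F) rows v).val.1 i)
    nlinarith

theorem insertVec_inl {bs : List (Fin d → F)} {rows : List (Row F d)} (h : IsEchelon bs rows)
    {v c : Fin d → F} (hc : (insertVec (Arith.ofField F) rows v).val = Sum.inl c) :
    v + famSum bs c = 0 := by
  obtain ⟨h1, -⟩ := reduce_comb rows h.vec_eq h.comb_eq_zero v
  simp only [insertVec, val_bind] at hc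
  split at hc
  · rename_i hp
    simp only [val_pure, Sum.inl.injEq] at hc
    rw [← hc, ← h1]
    funext i
    exact findPivot_none _ _ hp i (List.mem_finRange i)
  · simp at hc

theorem insertVec_inr {bs : List (Fin d → F)} {rows rows' : List (Row F d)} (h : IsEchelon bs rows)
    {v : Fin d → F} (hc : (insertVec (Arith.ofField F) rows v).val = Sum.inr rows') :
    IsEchelon (bs ++ [v]) rows' := by
  obtain ⟨h1, h2⟩ := reduce_comb rows h.vec_eq h.comb_eq_zero v
  have h3 := reduce_pivot rows h.vec_pivot h.pairwise v
  simp only [insertVec, val_bind] at hc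
  split at hc
  · simp at hc
  · rename_i i hp
    have hne := findPivot_some _ _ hp
    simp only [val_bind, val_divVec, val_pure, Sum.inr.injEq] at hc
    subst hc
    set p := (reduce (Arith.ofField F) rows v).val
    -- The new pivot differs from the old ones, so there is still a free slot in the coefficient
    -- vector for the new member of the family.
    have hlt : rows.length < d := by
      have hnd : (i :: rows.map Row.pivot).Nodup := by
        refine List.nodup_cons.2 ⟨?_, h.nodup_pivot⟩
        intro hi
        obtain ⟨r, hr, hri⟩ := List.mem_map.1 hi
        exact hne (hri ▸ h3 r hr)
      simpa using hnd.length_le_card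
    have hsum : famSum (bs ++ [v]) (fun j => if j.val = rows.length then (Arith.ofField F).one
        else p.2 j) = p.1 := by
      have hz := famSum_append h2 v
      rw [h1, ← hz, ← sub_eq_iff_eq_add]
      rw [famSum, famSum, ← Finset.sum_sub_distrib, Finset.sum_eq_single ⟨rows.length, hlt⟩]
      · simp [h.length_eq, Arith.ofField, h2]
      · intro j _ hj
        have : j.val ≠ rows.length := fun h' => hj (Fin.ext h')
        simp [this]
      · simp
    refine ⟨by simp [h.length_eq], ?_, ?_, ?_, ?_⟩
    · intro r hr
      rcases List.mem_append.1 hr with hr | hr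
      · exact h.vec_pivot r hr
      · rw [List.mem_singleton.1 hr]
        simp [inv_mul_cancel₀ hne]
    · intro r hr
      rcases List.mem_append.1 hr with hr | hr
      · rw [famSum_append (h.comb_eq_zero r hr)]
        exact h.vec_eq r hr
      · rw [List.mem_singleton.1 hr]
        simp only
        rw [famSum_smul, hsum]
    · intro r hr j hj
      have hj' : bs.length + 1 ≤ j.val := by simpa using hj
      rcases List.mem_append.1 hr with hr | hr
      · exact h.comb_eq_zero r hr j (by omega)
      · have h5 : j.val ≠ rows.length := by rw [h.length_eq]; omega
        rw [List.mem_singleton.1 hr]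
        simp [h5, h2 j (by omega : bs.length ≤ j.val)]
    · rw [List.pairwise_append]
      refine ⟨h.pairwise, List.pairwise_singleton _ _, ?_⟩
      intro r hr s hs
      rw [List.mem_singleton.1 hs]
      simp [h3 r hr]

/-- Reduction by an echelon form of full length expresses every vector. -/
theorem IsEchelon.add_famSum_reduce {bs : List (Fin d → F)} {rows : List (Row F d)}
    (h : IsEchelon bs rows) (hd : bs.length = d) (v : Fin d → F) :
    v + famSum bs (reduce (Arith.ofField F) rows v).val.2 = 0 := by
  rw [← (reduce_comb rows h.vec_eq h.comb_eq_zero v).1]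
  funext i
  have hmem : i ∈ rows.map Row.pivot := by
    have hcard : (rows.map Row.pivot).toFinset = Finset.univ := by
      rw [← Finset.card_eq_iff_eq_univ, List.toFinset_card_of_nodup h.nodup_pivot]
      simp [h.length_eq, hd]
    rw [← List.mem_toFinset, hcard]
    exact Finset.mem_univ i
  obtain ⟨r, hr, rfl⟩ := List.mem_map.1 hmem
  exact reduce_pivot rows h.vec_pivot h.pairwise v r hr

/-- The echelon form of a family in which no vector depends on the preceding ones. -/
theorem isEchelon_echelon (bs : List (Fin d → F))
    (hbs : ∀ l v l', bs = l ++ v :: l' → v ∉ Submodule.span F {b | b ∈ l}) :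
    IsEchelon bs (echelon (Arith.ofField F) bs).val := by
  suffices H : ∀ (l' l : List (Fin d → F)) (rows : List (Row F d)), bs = l ++ l' →
      IsEchelon l rows → IsEchelon bs (loop (fun rows v =>
        (insertVec (Arith.ofField F) rows v).bind fun res =>
        match res with
        | Sum.inl _ => Counted.pure rows
        | Sum.inr rows' => Counted.pure rows') rows l').val from
    H bs [] [] rfl IsEchelon.nil
  intro l'
  induction l' with
  | nil =>
    rintro l rows rfl h
    simpa using h
  | cons v l' ih =>
    intro l rows hl h
    rw [val_loop_cons]
    refine ih (l ++ [v]) _ (by simp [hl]) ?_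
    rw [val_bind]
    cases hres : (insertVec (Arith.ofField F) rows v).val with
    | inl c =>
      exfalso
      refine hbs l v l' hl ?_
      rw [eq_neg_of_add_eq_zero_left (insertVec_inl h hres)]
      exact Submodule.neg_mem _ (famSum_mem_span l c)
    | inr rows' => exact insertVec_inr h hres

theorem length_insertVec_le {rows rows' : List (Row F d)} {v : Fin d → F}
    (h : (insertVec (Arith.ofField F) rows v).val = Sum.inr rows') :
    rows'.length = rows.length + 1 := by
  simp only [insertVec, val_bind] at h
  split at h
  · simp at h
  · simp only [val_bind, val_pure, Sum.inr.injEq] at h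
    rw [← h]
    simp

/-- Each vector adds at most one row, so there are never more than `d` rows, as `ops_insertVec_le`
requires; whether the vectors are independent plays no role. -/
theorem length_ops_echelon_le {bs : List (Fin d → F)} (hbs : bs.length ≤ d) :
    (echelon (Arith.ofField F) bs).val.length ≤ bs.length ∧
      (echelon (Arith.ofField F) bs).ops ≤ bs.length * (7 * d ^ 2) := by
  suffices H : ∀ (l : List (Fin d → F)) (rows : List (Row F d)), rows.length + l.length ≤ d →
      (loop (fun rows v =>
        (insertVec (Arith.ofField F) rows v).bind fun res =>
        match res with
        | Sum.inl _ => Counted.pure rows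
        | Sum.inr rows' => Counted.pure rows') rows l).val.length ≤ rows.length + l.length ∧
      (loop (fun rows v =>
        (insertVec (Arith.ofField F) rows v).bind fun res =>
        match res with
        | Sum.inl _ => Counted.pure rows
        | Sum.inr rows' => Counted.pure rows') rows l).ops ≤ l.length * (7 * d ^ 2) by
    have := H bs [] (by simpa using hbs)
    rw [List.length_nil, zero_add] at this
    exact this
  intro l
  induction l with
  | nil => simp
  | cons v l ih =>
    intro rows hl
    rw [List.length_cons] at hl ⊢
    have h1 := ops_insertVec_le (show rows.length ≤ d by omega) v
    rw [val_loop_cons, ops_loop_cons, ops_bind, val_bind, add_mul]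
    cases hres : (insertVec (Arith.ofField F) rows v).val with
    | inl c =>
      obtain ⟨h2, h3⟩ := ih rows (by omega)
      simp only [ops_pure, val_pure]
      constructor <;> omega
    | inr rows' =>
      have h4 := length_insertVec_le hres
      obtain ⟨h2, h3⟩ := ih rows' (by omega)
      simp only [ops_pure, val_pure]
      constructor <;> omega

end LinearAlgebra

/-! ## The classical FGLM algorithm -/

section FGLM

open Counted

variable {F : Type*} [Field F] {n d : ℕ}

/-- `c μ` is the vector of coordinates of the monomial `μ`, given the matrices `U i` of
multiplication by the variables and the coordinates `w` of `1`. -/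
structure IsCoord {R : Type*} [CommRing R] (U : Fin n → Fin d → Fin d → R) (w : Fin d → R)
    (c : (Fin n →₀ ℕ) → Fin d → R) : Prop where
  zero : c 0 = w
  add_single : ∀ i μ, c (μ + Finsupp.single i 1) = fun a => ∑ b, U i a b * c μ b

/-- Lets the computations over the residue field and over `K` share one integral coordinate
function. -/
theorem IsCoord.map {R S : Type*} [CommRing R] [CommRing S] {U : Fin n → Fin d → Fin d → R}
    {w : Fin d → R} {c : (Fin n →₀ ℕ) → Fin d → R} (h : IsCoord U w c) (φ : R →+* S) :
    IsCoord (fun i a b => φ (U i a b)) (fun a => φ (w a)) fun μ a => φ (c μ a) where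
  zero := by rw [h.zero]
  add_single i μ := by
    rw [h.add_single]
    simp

/-- `μ` is `1` or the product of a variable and a member of `B`. -/
def IsNext (B : List (Fin n →₀ ℕ)) (μ : Fin n →₀ ℕ) : Prop :=
  μ = 0 ∨ ∃ i, ∃ β ∈ B, μ = β + Finsupp.single i 1

theorem IsNext.append {B : List (Fin n →₀ ℕ)} {μ : Fin n →₀ ℕ} (h : IsNext B μ)
    (B' : List (Fin n →₀ ℕ)) : IsNext (B ++ B') μ := by
  rcases h with h | ⟨i, β, hβ, h⟩
  · exact Or.inl h
  · exact Or.inr ⟨i, β, List.mem_append_left _ hβ, h⟩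

/-- Each member of the list is `1` or the product of a variable and a preceding member. -/
inductive IsChain : List (Fin n →₀ ℕ) → Prop
  | nil : IsChain []
  | snoc {B : List (Fin n →₀ ℕ)} {μ : Fin n →₀ ℕ} : IsChain B → IsNext B μ → IsChain (B ++ [μ])

/-- Whichever factorization `X_i μ'` is found, the result is the same, because `c` is a function of
the monomial alone. `IsNext` guarantees that the fallback value `w` is used only for `μ = 1`. -/
theorem val_monomialVec {U : Fin n → Fin d → Fin d → F} {w : Fin d → F}
    {c : (Fin n →₀ ℕ) → Fin d → F} (hc : IsCoord U w c)
    {T : List ((Fin n →₀ ℕ) × (Fin d → F))} (hT : ∀ p ∈ T, p.2 = c p.1) {μ : Fin n →₀ ℕ}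
    (hμ : IsNext (T.map Prod.fst) μ) :
    (monomialVec (Arith.ofField F) U w T μ).val = c μ := by
  unfold monomialVec
  split
  · rename_i i v h
    obtain ⟨j, -, hj⟩ := List.exists_of_findSome?_eq_some h
    obtain ⟨p, hp, hpj⟩ := Option.map_eq_some_iff.1 hj
    obtain ⟨rfl, rfl⟩ := Prod.mk.inj hpj
    have h1 := List.find?_some hp
    have h2 := List.mem_of_find?_eq_some hp
    rw [val_matVec, ← of_decide_eq_true h1, hc.add_single, hT p h2]
  · rename_i h
    rcases hμ with rfl | ⟨i, β, hβ, rfl⟩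
    · exact hc.zero.symm
    · exfalso
      obtain ⟨p, hp, rfl⟩ := List.mem_map.1 hβ
      have h1 := List.findSome?_eq_none_iff.1 h i (List.mem_finRange i)
      rw [Option.map_eq_none_iff, List.find?_eq_none] at h1
      simpa using h1 p hp

theorem ops_monomialVec_le (U : Fin n → Fin d → Fin d → F) (w : Fin d → F)
    (T : List ((Fin n →₀ ℕ) × (Fin d → F))) (μ : Fin n →₀ ℕ) :
    (monomialVec (Arith.ofField F) U w T μ).ops ≤ 2 * d ^ 2 := by
  unfold monomialVec
  split
  · refine (ops_matVec_le _ _).trans ?_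
    nlinarith
  · simp

theorem val_monomialTable {U : Fin n → Fin d → Fin d → F} {w : Fin d → F}
    {c : (Fin n →₀ ℕ) → Fin d → F} (hc : IsCoord U w c) {B : List (Fin n →₀ ℕ)} (hB : IsChain B) :
    (monomialTable (Arith.ofField F) U w B).val = B.map fun μ => (μ, c μ) := by
  induction hB with
  | nil => rfl
  | @snoc B μ _ hμ ih =>
    rw [monomialTable, val_loop] at ih ⊢
    rw [List.foldl_append, ih, List.foldl_cons, List.foldl_nil, List.map_append]
    simp only [val_bind, val_pure, List.map_cons, List.map_nil]
    rw [val_monomialVec hc]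
    · simp
    · simpa [Function.comp_def] using hμ

theorem ops_monomialTable_le (U : Fin n → Fin d → Fin d → F) (w : Fin d → F)
    (B : List (Fin n →₀ ℕ)) :
    (monomialTable (Arith.ofField F) U w B).ops ≤ B.length * (2 * d ^ 2) :=
  ops_loop_le _ (fun T μ => ops_monomialVec_le U w T μ) _

/-- The monomial is in the list `B` or is a multiple of the leading monomial of a member of `G`. -/
def IsCovered {S : Type*} (B : List (Fin n →₀ ℕ)) (G : List (MonicPoly S n))
    (μ : Fin n →₀ ℕ) : Prop :=
  μ ∈ B ∨ ∃ g ∈ G, g.lead ≤ μ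

theorem IsCovered.mono {S : Type*} {B B' : List (Fin n →₀ ℕ)} {G G' : List (MonicPoly S n)}
    {μ : Fin n →₀ ℕ} (h : IsCovered B G μ) (hB : B ⊆ B') (hG : G ⊆ G') : IsCovered B' G' μ := by
  rcases h with h | ⟨g, hg, h⟩
  · exact Or.inl (hB h)
  · exact Or.inr ⟨g, hG hg, h⟩

/-- The leading monomials of `G` are next to the staircase `B`, and their coordinates depend
linearly on those of the smaller members of `B`. -/
structure IsLeads (m : MonomialOrder (Fin n)) (c : (Fin n →₀ ℕ) → Fin d → F)
    (B : List (Fin n →₀ ℕ)) (G : List (MonicPoly F n)) : Prop where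
  next : ∀ g ∈ G, IsNext B g.lead
  notMem : ∀ g ∈ G, g.lead ∉ B
  mem_span : ∀ g ∈ G, c g.lead ∈
    Submodule.span F (c '' {β | β ∈ B ∧ m.toSyn β < m.toSyn g.lead})

/-- The invariant of the classical FGLM algorithm; `k` is the number of steps performed. -/
structure FGLMInv (m : MonomialOrder (Fin n)) (c : (Fin n →₀ ℕ) → Fin d → F) (k : ℕ)
    (st : FGLMState F n d) : Prop where
  -- Each effective step removes at least one entry, and each staircase member contributes `n`. The
  -- first alternative allows for idle steps once the list is exhausted; the inequality allows for
  -- duplicates, which are all removed together.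
  todo_length : st.todo = [] ∨ st.todo.length + k ≤ 1 + n * st.stairs.length
  basis_length : st.basis.length ≤ k
  vec_eq : ∀ p ∈ st.stairs, p.2 = c p.1
  echelon : IsEchelon (st.stairs.map Prod.snd) st.rows
  -- This turns linear dependence on the current staircase into dependence on strictly smaller
  -- monomials.
  lt_todo : ∀ β ∈ st.stairs.map Prod.fst, ∀ ν ∈ st.todo, m.toSyn β < m.toSyn ν
  chain : IsChain (st.stairs.map Prod.fst)
  todo_next : ∀ ν ∈ st.todo, IsNext (st.stairs.map Prod.fst) ν
  leads : IsLeads m c (st.stairs.map Prod.fst) st.basis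
  cover : ∀ ν, IsNext (st.stairs.map Prod.fst) ν →
    ν ∈ st.todo ∨ IsCovered (st.stairs.map Prod.fst) st.basis ν

theorem FGLMInv.init (m : MonomialOrder (Fin n)) (c : (Fin n →₀ ℕ) → Fin d → F) :
    FGLMInv m c 0 (⟨[0], [], [], []⟩ : FGLMState F n d) where
  todo_length := by simp
  basis_length := by simp
  vec_eq := by simp
  echelon := IsEchelon.nil
  lt_todo := by simp
  chain := IsChain.nil
  todo_next := by simp [IsNext]
  leads := by constructor <;> simp
  cover := by simp [IsNext]

theorem lt_of_mem_filter {m : MonomialOrder (Fin n)} {l : List (Fin n →₀ ℕ)} {μ : Fin n →₀ ℕ}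
    (h : μ ∈ l.argmin m.toSyn) {ν : Fin n →₀ ℕ} (hν : ν ∈ l.filter fun ν => decide (ν ≠ μ)) :
    m.toSyn μ < m.toSyn ν := by
  obtain ⟨h1, h2⟩ := List.mem_filter.1 hν
  refine lt_of_le_of_ne (List.le_of_mem_argmin h1 h) fun h3 => ?_
  exact of_decide_eq_true h2 (m.toSyn.injective h3).symm

/-- The smallest candidate is discarded as a multiple of a known leading monomial, becomes a leading
monomial, or joins the staircase. In each case it ends up covered, and only the last case creates
new neighbours, all of which become candidates. The cost is one matrix-vector product, `2d²`, plus
one insertion, `7d²`. -/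
theorem FGLMInv.step {m : MonomialOrder (Fin n)} {U : Fin n → Fin d → Fin d → F} {w : Fin d → F}
    {c : (Fin n →₀ ℕ) → Fin d → F} (hc : IsCoord U w c) {k : ℕ} {st : FGLMState F n d}
    (h : FGLMInv m c k st) :
    FGLMInv m c (k + 1) (fglmStep m (Arith.ofField F) U w st).val ∧
      (fglmStep m (Arith.ofField F) U w st).ops ≤ 9 * d ^ 2 := by
  unfold fglmStep
  split
  · rename_i hnone
    have htodo := List.argmin_eq_none.1 hnone
    refine ⟨?_, by simp⟩
    exact ⟨Or.inl htodo, h.basis_length.trans (Nat.le_succ k), h.vec_eq, h.echelon, h.lt_todo,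
      h.chain, h.todo_next, h.leads, h.cover⟩
  rename_i μ hμ
  have hmem : μ ∈ st.todo := List.argmin_mem hμ
  have hrest : ∀ ν, ν ∈ st.todo.filter (fun ν => decide (ν ≠ μ)) ↔ ν ∈ st.todo ∧ ν ≠ μ := by
    simp
  have hlen : (st.todo.filter fun ν => decide (ν ≠ μ)).length + 1 ≤ st.todo.length := by
    refine Nat.succ_le_of_lt (List.length_filter_lt_length_iff_exists.2 ⟨μ, hmem, by simp⟩)
  have hk : st.todo.length + k ≤ 1 + n * st.stairs.length :=
    h.todo_length.resolve_left (List.ne_nil_of_mem hmem)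
  split_ifs with hany
  · obtain ⟨g, hg, hgμ⟩ := List.any_eq_true.1 hany
    replace hgμ : g.lead ≤ μ := of_decide_eq_true hgμ
    refine ⟨?_, by simp⟩
    refine ⟨Or.inr ?_, h.basis_length.trans (Nat.le_succ k), h.vec_eq, h.echelon, ?_,
      h.chain, ?_, h.leads, ?_⟩
    · simp only [val_pure]
      omega
    · exact fun β hβ ν hν => h.lt_todo β hβ ν ((hrest ν).1 hν).1
    · exact fun ν hν => h.todo_next ν ((hrest ν).1 hν).1
    · intro ν hν
      by_cases hνμ : ν = μ
      · exact Or.inr (Or.inr ⟨g, hg, hνμ ▸ hgμ⟩)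
      · exact (h.cover ν hν).imp_left fun h' => (hrest ν).2 ⟨h', hνμ⟩
  have hnlead : ∀ g ∈ st.basis, ¬ g.lead ≤ μ := by
    intro g hg hgμ
    exact hany (List.any_eq_true.2 ⟨g, hg, decide_eq_true hgμ⟩)
  have hv := val_monomialVec hc h.vec_eq (h.todo_next μ hmem)
  have hops := ops_monomialVec_le U w st.stairs μ
  have hops' := ops_insertVec_le h.echelon.length_le (c μ)
  simp only [val_bind, ops_bind, hv]
  cases hres : (insertVec (Arith.ofField F) st.rows (c μ)).val with
  | inl e =>
    refine ⟨?_, by simp only [ops_pure]; omega⟩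
    have hsub : st.basis ⊆
        st.basis ++ [MonicPoly.mk' μ (st.stairs.map Prod.fst) e] := List.subset_append_left _ _
    have hnew : ∀ {p : MonicPoly F n → Prop}, (∀ g ∈ st.basis, p g) →
        p (MonicPoly.mk' μ (st.stairs.map Prod.fst) e) →
        ∀ g ∈ st.basis ++ [MonicPoly.mk' μ (st.stairs.map Prod.fst) e], p g := by
      intro p h1 h2 g hg
      rcases List.mem_append.1 hg with hg | hg
      · exact h1 g hg
      · exact List.mem_singleton.1 hg ▸ h2
    refine ⟨Or.inr ?_, ?_, h.vec_eq, h.echelon, ?_, h.chain, ?_, ⟨?_, ?_, ?_⟩, ?_⟩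
    · simp only [val_pure]
      omega
    · have := h.basis_length
      simp only [val_pure, List.length_append, List.length_singleton]
      omega
    · exact fun β hβ ν hν => h.lt_todo β hβ ν ((hrest ν).1 hν).1
    · exact fun ν hν => h.todo_next ν ((hrest ν).1 hν).1
    · exact hnew h.leads.next (h.todo_next μ hmem)
    · refine hnew h.leads.notMem fun hμB => ?_
      exact lt_irrefl _ (h.lt_todo μ hμB μ hmem)
    · refine hnew h.leads.mem_span ?_
      have h1 := eq_neg_of_add_eq_zero_left (insertVec_inl h.echelon hres)
      change c μ ∈ _
      rw [h1]
      refine Submodule.neg_mem _ (Submodule.span_mono ?_ (famSum_mem_span _ _))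
      intro b hb
      obtain ⟨p, hp, rfl⟩ := List.mem_map.1 hb
      have hp' := List.mem_map_of_mem (f := Prod.fst) hp
      exact ⟨p.1, ⟨hp', h.lt_todo _ hp' μ hmem⟩, (h.vec_eq p hp).symm⟩
    · intro ν hν
      by_cases hνμ : ν = μ
      · exact Or.inr (Or.inr ⟨_, List.mem_append_right _ (List.mem_singleton_self _), hνμ.ge⟩)
      · exact (h.cover ν hν).imp (fun h' => (hrest ν).2 ⟨h', hνμ⟩)
          fun h' => h'.mono (List.Subset.refl _) hsub
  | inr rows' =>
    refine ⟨?_, by simp only [ops_pure]; omega⟩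
    have hfst : (st.stairs ++ [(μ, c μ)]).map Prod.fst = st.stairs.map Prod.fst ++ [μ] := by simp
    have hsub : st.stairs.map Prod.fst ⊆ st.stairs.map Prod.fst ++ [μ] :=
      List.subset_append_left _ _
    have htodo : ∀ {p : (Fin n →₀ ℕ) → Prop}, (∀ ν ∈ st.todo, m.toSyn μ < m.toSyn ν → p ν) →
        (∀ i, p (μ + Finsupp.single i 1)) →
        ∀ ν ∈ (st.todo.filter fun ν => decide (ν ≠ μ)) ++
          (List.finRange n).map (fun i => μ + Finsupp.single i 1), p ν := by
      intro p h1 h2 ν hν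
      rcases List.mem_append.1 hν with hν | hν
      · exact h1 ν ((hrest ν).1 hν).1 (lt_of_mem_filter hμ hν)
      · obtain ⟨i, -, rfl⟩ := List.mem_map.1 hν
        exact h2 i
    have hlt : ∀ i, m.toSyn μ < m.toSyn (μ + Finsupp.single i 1) := fun i =>
      m.toSyn_strictMono (lt_add_of_pos_right _ (by
        rw [pos_iff_ne_zero, Ne, Finsupp.single_eq_zero]
        exact one_ne_zero))
    constructor <;> simp only [val_pure, hfst]
    · right
      simp only [List.length_append, List.length_map, List.length_finRange, List.length_singleton,
        mul_add, mul_one]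
      omega
    · exact h.basis_length.trans (Nat.le_succ k)
    · intro p hp
      rcases List.mem_append.1 hp with hp | hp
      · exact h.vec_eq p hp
      · rw [List.mem_singleton.1 hp]
    · rw [List.map_append]
      exact insertVec_inr h.echelon hres
    · intro β hβ
      refine htodo (fun ν hν hμν => ?_) fun i => ?_
      · rcases List.mem_append.1 hβ with hβ | hβ
        · exact h.lt_todo β hβ ν hν
        · exact List.mem_singleton.1 hβ ▸ hμν
      · rcases List.mem_append.1 hβ with hβ | hβ
        · exact (h.lt_todo β hβ μ hmem).trans (hlt i)
        · exact List.mem_singleton.1 hβ ▸ hlt i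
    · exact h.chain.snoc (h.todo_next μ hmem)
    · exact htodo (fun ν hν _ => (h.todo_next ν hν).append _) fun i =>
        Or.inr ⟨i, μ, List.mem_append_right _ (List.mem_singleton_self _), rfl⟩
    · refine ⟨fun g hg => (h.leads.next g hg).append _, fun g hg hgB => ?_, fun g hg => ?_⟩
      · rcases List.mem_append.1 hgB with hgB | hgB
        · exact h.leads.notMem g hg hgB
        -- An earlier leading monomial equal to `μ` would have caused `μ` to be skipped.
        · exact hnlead g hg (List.mem_singleton.1 hgB).le
      · refine Submodule.span_mono (Set.image_mono ?_) (h.leads.mem_span g hg)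
        exact fun β hβ => ⟨hsub hβ.1, hβ.2⟩
    · have hold : ∀ ν, (ν ∈ st.todo ∨ IsCovered (st.stairs.map Prod.fst) st.basis ν) →
          (ν ∈ (st.todo.filter fun ν => decide (ν ≠ μ)) ++
            (List.finRange n).map (fun i => μ + Finsupp.single i 1) ∨
          IsCovered (st.stairs.map Prod.fst ++ [μ]) st.basis ν) := by
        rintro ν (hν | hν)
        · by_cases hνμ : ν = μ
          · exact Or.inr (Or.inl (hνμ ▸ List.mem_append_right _ (List.mem_singleton_self _)))
          · exact Or.inl (List.mem_append_left _ ((hrest ν).2 ⟨hν, hνμ⟩))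
        · exact Or.inr (hν.mono hsub (List.Subset.refl _))
      rintro ν (hν | ⟨i, β, hβ, hν⟩)
      · exact hold ν (h.cover ν (Or.inl hν))
      · rcases List.mem_append.1 hβ with hβ | hβ
        · exact hold ν (h.cover ν (Or.inr ⟨i, β, hβ, hν⟩))
        · left
          refine List.mem_append_right _ (List.mem_map.2 ⟨i, List.mem_finRange i, ?_⟩)
          rw [hν, List.mem_singleton.1 hβ]

/-- Coordinates depend linearly on those of the staircase members that are not larger. -/
theorem mem_span_of_isCovered {m : MonomialOrder (Fin n)} {U : Fin n → Fin d → Fin d → F}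
    {w : Fin d → F} {c : (Fin n →₀ ℕ) → Fin d → F} (hc : IsCoord U w c)
    {B : List (Fin n →₀ ℕ)} {G : List (MonicPoly F n)} (hG : IsLeads m c B G)
    (hcov : ∀ μ, IsCovered B G μ) (μ : Fin n →₀ ℕ) :
    c μ ∈ Submodule.span F (c '' {β | β ∈ B ∧ m.toSyn β ≤ m.toSyn μ}) := by
  -- Multiplication by a fixed monomial acts on coordinates through a product of the matrices `U i`,
  -- hence linearly.
  have hshift : ∀ τ : Fin n →₀ ℕ, ∃ L : (Fin d → F) →ₗ[F] (Fin d → F),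
      ∀ ν, c (ν + τ) = L (c ν) := by
    intro τ
    induction τ using Finsupp.induction_linear with
    | zero => exact ⟨LinearMap.id, by simp⟩
    | add f g hf hg =>
      obtain ⟨L, hL⟩ := hf
      obtain ⟨L', hL'⟩ := hg
      exact ⟨L'.comp L, fun ν => by rw [← add_assoc, hL', hL]; rfl⟩
    | single i k =>
      induction k with
      | zero => exact ⟨LinearMap.id, by simp⟩
      | succ k ih =>
        obtain ⟨L, hL⟩ := ih
        refine ⟨(Matrix.mulVecLin (Matrix.of (U i))).comp L, fun ν => ?_⟩
        rw [Finsupp.single_add, ← add_assoc, hc.add_single, hL]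
        rfl
  induction hs : m.toSyn μ using WellFoundedLT.induction generalizing μ with
  | ind s ih =>
    subst hs
    rcases hcov μ with hμ | ⟨g, hg, hgμ⟩
    · exact Submodule.subset_span ⟨μ, ⟨hμ, le_rfl⟩, rfl⟩
    -- Multiplying the relation for `g.lead` by `X^τ` expresses `c μ` through monomials `β + τ`
    -- smaller than `μ`. These may leave the staircase, so the induction hypothesis is applied to
    -- them.
    · obtain ⟨τ, rfl⟩ := exists_add_of_le hgμ
      obtain ⟨L, hL⟩ := hshift τ
      rw [hL]
      have h1 := Submodule.mem_map_of_mem (f := L) (hG.mem_span g hg)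
      rw [Submodule.map_span] at h1
      refine Submodule.span_le.2 ?_ h1
      rintro _ ⟨_, ⟨β, ⟨hβ, hlt⟩, rfl⟩, rfl⟩
      have h2 : m.toSyn (β + τ) < m.toSyn (g.lead + τ) := by
        rw [map_add, map_add]
        exact add_lt_add_left hlt _
      rw [← hL]
      refine Submodule.span_mono (Set.image_mono ?_) (ih _ h2 _ rfl)
      exact fun γ hγ => ⟨hγ.1, hγ.2.trans h2.le⟩

/-- The output of the classical FGLM algorithm: the staircase `B` is a monomial basis, and the
leading monomials of `G` generate the complement of the staircase. -/
structure FGLMSpec (m : MonomialOrder (Fin n)) (c : (Fin n →₀ ℕ) → Fin d → F)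
    (G : List (MonicPoly F n)) (B : List (Fin n →₀ ℕ)) : Prop where
  chain : IsChain B
  leads : IsLeads m c B G
  cover : ∀ μ, IsCovered B G μ
  length_le : B.length ≤ d
  basis_length : G.length ≤ n * d + 1

/-- With no candidate left, `1` and all neighbours of the staircase are covered. Being covered is
then stable under multiplication by a variable, so every monomial is covered. -/
theorem fglmField_spec {m : MonomialOrder (Fin n)} {U : Fin n → Fin d → Fin d → F} {w : Fin d → F}
    {c : (Fin n →₀ ℕ) → Fin d → F} (hc : IsCoord U w c) :
    FGLMSpec m c (fglmField m (Arith.ofField F) U w).val.1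
        (fglmField m (Arith.ofField F) U w).val.2 ∧
      (fglmField m (Arith.ofField F) U w).ops ≤ (n * d + 1) * (9 * d ^ 2) := by
  obtain ⟨h, hops⟩ := loop_invariant
    (f := fun st (_ : ℕ) => fglmStep m (Arith.ofField F) U w st) (FGLMInv m c)
    (List.range (n * d + 1)) (fun k b _ _ hb => hb.step hc) (FGLMInv.init m c)
  rw [List.length_range, zero_add] at h
  rw [List.length_range] at hops
  refine ⟨?_, hops⟩
  simp only [fglmField, val_bind, val_pure]
  revert h
  generalize (loop (fun st (_ : ℕ) => fglmStep m (Arith.ofField F) U w st) ⟨[0], [], [], []⟩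
    (List.range (n * d + 1))).val = st
  intro h
  have hlen : st.stairs.length ≤ d := by
    have h1 := h.echelon.length_le
    rwa [h.echelon.length_eq, List.length_map] at h1
  -- Since the staircase has at most `d` members, after `n * d + 1` steps the counting invariant
  -- leaves room for no candidate.
  have htodo : st.todo = [] := by
    rcases h.todo_length with h1 | h1
    · exact h1
    · have := Nat.mul_le_mul_left n hlen
      exact List.length_eq_zero_iff.1 (by omega)
  have hcov : ∀ ν, IsNext (st.stairs.map Prod.fst) ν →
      IsCovered (st.stairs.map Prod.fst) st.basis ν := by
    intro ν hν
    simpa [htodo] using h.cover ν hν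
  have hstep : ∀ (i : Fin n) (μ : Fin n →₀ ℕ), IsCovered (st.stairs.map Prod.fst) st.basis μ →
      IsCovered (st.stairs.map Prod.fst) st.basis (μ + Finsupp.single i 1) := by
    rintro i μ (hμ | ⟨g, hg, hμ⟩)
    · exact hcov _ (Or.inr ⟨i, μ, hμ, rfl⟩)
    · exact Or.inr ⟨g, hg, hμ.trans le_self_add⟩
  have hadd : ∀ τ μ : Fin n →₀ ℕ, IsCovered (st.stairs.map Prod.fst) st.basis μ →
      IsCovered (st.stairs.map Prod.fst) st.basis (μ + τ) := by
    intro τ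
    induction τ using Finsupp.induction_linear with
    | zero => simp
    | add f g hf hg => exact fun μ hμ => add_assoc μ f g ▸ hg _ (hf _ hμ)
    | single i k =>
      induction k with
      | zero => simp
      | succ k ih =>
        intro μ hμ
        rw [Finsupp.single_add, ← add_assoc]
        exact hstep i _ (ih μ hμ)
  refine ⟨h.chain, h.leads, fun μ => ?_, by simpa using hlen, h.basis_length⟩
  have := hadd μ 0 (hcov 0 (Or.inl rfl))
  rwa [zero_add] at this

end FGLM

/-! ### Lifting bases and relations from the residue field to the local ring. -/

section Lifting

open Counted

variable {n d : ℕ}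

/-- The staircase consists of `d` monomials whose coordinates are a basis. -/
theorem FGLMSpec.exists_basis {k : Type*} [Field k] {m : MonomialOrder (Fin n)}
    {U : Fin n → Fin d → Fin d → k} {w : Fin d → k} {c : (Fin n →₀ ℕ) → Fin d → k}
    (hc : IsCoord U w c) {G : List (MonicPoly k n)} {B : List (Fin n →₀ ℕ)}
    (h : FGLMSpec m c G B) (hspan : Submodule.span k (Set.range c) = ⊤) :
    ∃ β : Fin d → Fin n →₀ ℕ, B = List.ofFn β ∧ LinearIndependent k fun j => c (β j) := by
  have htop : ⊤ ≤ Submodule.span k (Set.range fun j : Fin B.length => c (B.get j)) := by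
    rw [← hspan]
    refine Submodule.span_le.2 ?_
    rintro _ ⟨μ, rfl⟩
    refine Submodule.span_mono ?_ (mem_span_of_isCovered hc h.leads h.cover μ)
    rintro _ ⟨β, ⟨hβ, -⟩, rfl⟩
    obtain ⟨j, rfl⟩ := List.get_of_mem hβ
    exact ⟨j, rfl⟩
  -- At most `d` because the echelon form has distinct pivots, at least `d` because the staircase
  -- spans.
  have hlen : B.length = d := by
    refine le_antisymm h.length_le ?_
    have := finrank_le_of_span_eq_top (top_le_iff.1 htop)
    simpa using this
  subst hlen
  refine ⟨B.get, (List.ofFn_get B).symm, ?_⟩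
  exact linearIndependent_of_top_le_span_of_card_eq_finrank htop (by simp)

theorem famSum_ofFn {k : Type*} [Field k] (u : Fin d → Fin d → k) (c : Fin d → k) :
    famSum (List.ofFn u) c = ∑ j, c j • u j := by
  refine Finset.sum_congr rfl fun j _ => ?_
  simp

theorem isEchelon_echelon_ofFn {k : Type*} [Field k] {u : Fin d → Fin d → k}
    (hu : LinearIndependent k u) :
    IsEchelon (List.ofFn u) (echelon (Arith.ofField k) (List.ofFn u)).val := by
  refine isEchelon_echelon _ fun l v l' hl => ?_
  have hlen : l.length < d := by
    have := congrArg List.length hl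
    simp at this
    omega
  have hget : ∀ j (hj : j < d), (l ++ v :: l')[j]? = some (u ⟨j, hj⟩) := by
    intro j hj
    rw [← hl]
    simp [hj]
  have hv : v = u ⟨l.length, hlen⟩ := by simpa using hget l.length hlen
  have hnot : (⟨l.length, hlen⟩ : Fin d) ∉ {j : Fin d | j.val < l.length} := by simp
  rw [hv]
  intro hmem
  refine hu.notMem_span_image hnot (Submodule.span_mono ?_ hmem)
  intro x hx
  obtain ⟨j, hj, rfl⟩ := List.getElem_of_mem hx
  refine ⟨⟨j, hj.trans hlen⟩, hj, ?_⟩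
  have := hget j (hj.trans hlen)
  rw [List.getElem?_append_left hj, List.getElem?_eq_getElem hj] at this
  exact (Option.some.inj this).symm

theorem sum_eq_of_linearIndependent {k : Type*} [Field k] {u : Fin d → Fin d → k}
    (hu : LinearIndependent k u) {a b : Fin d → k} (h : ∑ j, a j • u j = ∑ j, b j • u j) :
    a = b := by
  funext j
  have h1 : ∑ j, (a j - b j) • u j = 0 := by
    simp only [sub_smul, Finset.sum_sub_distrib, h, sub_self]
  exact sub_eq_zero.1 (Fintype.linearIndependent_iff.1 hu _ h1 j)

theorem eq_zero_of_sum_mem_span {k : Type*} [Field k] {u : Fin d → Fin d → k}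
    (hu : LinearIndependent k u) {a : Fin d → k} {s : Set (Fin d)}
    (h : ∑ j, a j • u j ∈ Submodule.span k (u '' s)) {j : Fin d} (hj : j ∉ s) : a j = 0 := by
  obtain ⟨l, hl, hsum⟩ := (Finsupp.mem_span_image_iff_linearCombination k).1 h
  rw [Finsupp.linearCombination_apply, Finsupp.sum_fintype _ _ fun i => zero_smul k (u i)] at hsum
  rw [← sum_eq_of_linearIndependent hu hsum]
  exact (Finsupp.mem_supported' k l).1 hl j hj

variable {R K : Type*} [CommRing R] [IsLocalRing R] [Field K] [Algebra R K]

/-- Vectors over a local ring that are independent over the residue field form a basis: they are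
independent over the field `K ⊇ R`, and every vector has integral coordinates. -/
theorem exists_integral_coord {u : Fin d → Fin d → R}
    (hu : LinearIndependent (IsLocalRing.ResidueField R)
      fun j a => IsLocalRing.residue R (u j a)) :
    LinearIndependent K (fun j a => algebraMap R K (u j a)) ∧
      ∀ v : Fin d → R, ∃ q : Fin d → R, ∑ j, q j • u j = v := by
  -- An element of a local ring with nonzero residue is a unit, so invertibility of a matrix can be
  -- tested on its reduction.
  have hdet : IsUnit (Matrix.of u).det := by
    rw [← IsLocalRing.residue_ne_zero_iff_isUnit, RingHom.map_det]
    have : LinearIndependent (IsLocalRing.ResidueField R)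
      ((IsLocalRing.residue R).mapMatrix (Matrix.of u)).row := hu
    rw [Matrix.linearIndependent_rows_iff_isUnit, Matrix.isUnit_iff_isUnit_det] at this
    exact this.ne_zero
  constructor
  · have : IsUnit ((algebraMap R K).mapMatrix (Matrix.of u)) := by
      rw [Matrix.isUnit_iff_isUnit_det, ← RingHom.map_det]
      exact hdet.map _
    exact Matrix.linearIndependent_rows_iff_isUnit.2 this
  · intro v
    refine ⟨Matrix.vecMul v (Matrix.of u)⁻¹, ?_⟩
    have h1 : Matrix.vecMul (Matrix.vecMul v (Matrix.of u)⁻¹) (Matrix.of u) = v := by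
      rw [Matrix.vecMul_vecMul, Matrix.nonsing_inv_mul _ hdet, Matrix.vecMul_one]
    funext a
    simpa [Matrix.vecMul, dotProduct] using congrFun h1 a

/-- The relations computed over `K` are integral, and modulo the maximal ideal they only involve
the smaller monomials of the staircase. -/
theorem exists_integral_relation {m : MonomialOrder (Fin n)} {c : (Fin n →₀ ℕ) → Fin d → R}
    {G : List (MonicPoly (IsLocalRing.ResidueField R) n)} {β : Fin d → Fin n →₀ ℕ}
    (hG : IsLeads m (fun μ a => IsLocalRing.residue R (c μ a)) (List.ofFn β) G)
    (hβ : LinearIndependent (IsLocalRing.ResidueField R)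
      fun j a => IsLocalRing.residue R (c (β j) a))
    {g : MonicPoly (IsLocalRing.ResidueField R) n} (hg : g ∈ G) {e : Fin d → K}
    (he : (fun a => algebraMap R K (c g.lead a)) +
      famSum (List.ofFn fun j a => algebraMap R K (c (β j) a)) e = 0) :
    ∃ q : Fin d → R, (∀ j, e j = algebraMap R K (q j)) ∧ c g.lead + ∑ j, q j • c (β j) = 0 ∧
      ∀ j, ¬ m.toSyn (β j) < m.toSyn g.lead → IsLocalRing.residue R (q j) = 0 := by
  obtain ⟨hK, hint⟩ := exists_integral_coord (K := K) hβ
  obtain ⟨q, hq⟩ := hint (-c g.lead)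
  refine ⟨q, ?_, by rw [hq, add_neg_cancel], ?_⟩
  -- Coordinates over `K` are unique, so the computed solution is the integral one.
  · refine congrFun (sum_eq_of_linearIndependent hK ?_)
    rw [famSum_ofFn, add_comm] at he
    rw [eq_neg_of_add_eq_zero_left he]
    funext a
    have := congrArg (algebraMap R K) (congrFun hq a)
    simpa [map_sum, Algebra.smul_def] using this.symm
  · intro j hj
    refine eq_zero_of_sum_mem_span hβ (s := {j | m.toSyn (β j) < m.toSyn g.lead})
      (a := fun j => IsLocalRing.residue R (q j)) ?_ hj
    have h1 : ∑ j, IsLocalRing.residue R (q j) • (fun a => IsLocalRing.residue R (c (β j) a))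
        = - fun a => IsLocalRing.residue R (c g.lead a) := by
      funext a
      have := congrArg (IsLocalRing.residue R) (congrFun hq a)
      simpa [map_sum] using this
    rw [h1]
    refine Submodule.neg_mem _ (Submodule.span_mono ?_ (hG.mem_span g hg))
    rintro _ ⟨μ, ⟨hμ, hlt⟩, rfl⟩
    obtain ⟨i, rfl⟩ := List.mem_ofFn.1 hμ
    exact ⟨i, hlt, rfl⟩

end Lifting

/-! ## Integral series and the unit ball -/

section Reduction

variable {R M : Type*} [CommRing R] [IsLocalRing R] [AddCommGroup M] [Module R M] {δ : ℕ}
  (b : Module.Basis (Fin δ) R M)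

/-- The coordinates of a vector modulo the maximal ideal. -/
def redCoord : M →ₗ[R] (Fin δ → IsLocalRing.ResidueField R) :=
  (Algebra.linearMap R (IsLocalRing.ResidueField R)).compLeft (Fin δ) ∘ₗ b.equivFun.toLinearMap

theorem redCoord_apply (x : M) :
    redCoord b x = fun k => IsLocalRing.residue R (b.equivFun x k) := rfl

theorem redCoord_zero : redCoord b 0 = 0 := map_zero _

theorem redCoord_smul (a : R) (x : M) :
    redCoord b (a • x) = IsLocalRing.residue R a • redCoord b x := by
  rw [map_smul]
  funext k
  exact Algebra.smul_def a (redCoord b x k)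

theorem redCoord_add_sum_smul {ι : Type*} (x : M) (s : Finset ι) (a : ι → R) (y : ι → M) :
    redCoord b (x + ∑ i ∈ s, a i • y i) =
      redCoord b x + ∑ i ∈ s, IsLocalRing.residue R (a i) • redCoord b (y i) := by
  rw [map_add, map_sum]
  simp only [redCoord_smul]

theorem exists_redCoord_eq (x : Fin δ → IsLocalRing.ResidueField R) :
    ∃ y : M, redCoord b y = x := by
  choose y hy using fun k => IsLocalRing.residue_surjective (R := R) (x k)
  refine ⟨b.equivFun.symm y, ?_⟩
  rw [redCoord_apply, LinearEquiv.apply_symm_apply]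
  exact funext hy

end Reduction

section Tate

variable {K : Type*} [Field K] [Valued K ℤᵐ⁰] {n : ℕ}

theorem termVal_zero (a : K) (i : Fin n →₀ ℕ) : termVal 0 a i = ord K a := by
  simp [termVal]

theorem ord_le_iff {a b : K} (ha : a ≠ 0) (hb : b ≠ 0) :
    ord K a ≤ ord K b ↔ Valued.v b ≤ (Valued.v a : ℤᵐ⁰) := by
  rw [ord, ord, neg_le_neg_iff,
    WithZero.log_le_log ((Valuation.ne_zero_iff _).2 hb) ((Valuation.ne_zero_iff _).2 ha)]

theorem ord_lt_iff {a b : K} (ha : a ≠ 0) (hb : b ≠ 0) :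
    ord K a < ord K b ↔ Valued.v b < (Valued.v a : ℤᵐ⁰) := by
  rw [← not_le, ord_le_iff hb ha, not_le]

theorem residue_eq_zero_iff_lt (a : 𝒪[K]) :
    IsLocalRing.residue 𝒪[K] a = 0 ↔ Valued.v (a : K) < (1 : ℤᵐ⁰) := by
  rw [IsLocalRing.residue_eq_zero_iff, IsLocalRing.mem_maximalIdeal, mem_nonunits_iff]
  exact Valuation.Integer.not_isUnit_iff_valuation_lt_one

/-- The coefficients of a series, as linear forms. -/
def coeffₗ (r : Fin n → ℚ) (i : Fin n →₀ ℕ) : tateAlgebra K r →ₗ[K] K :=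
  MvPowerSeries.coeff i ∘ₗ (tateAlgebra K r).val.toLinearMap

theorem coeffₗ_apply (r : Fin n → ℚ) (i : Fin n →₀ ℕ) (f : tateAlgebra K r) :
    coeffₗ r i f = MvPowerSeries.coeff i f.1 := rfl

theorem ext_coeffₗ {r : Fin n → ℚ} {f g : tateAlgebra K r}
    (h : ∀ i, coeffₗ r i f = coeffₗ r i g) : f = g :=
  Subtype.ext (MvPowerSeries.ext h)

theorem coeffₗ_ofPolynomial (r : Fin n → ℚ) (i : Fin n →₀ ℕ) (p : MvPolynomial (Fin n) K) :
    coeffₗ r i (ofPolynomial r p) = MvPolynomial.coeff i p :=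
  MvPolynomial.coeff_coe p i

/-- A polynomial, seen in the Tate algebra, as an algebra homomorphism. -/
def ofPolynomialₐ (r : Fin n → ℚ) : MvPolynomial (Fin n) K →ₐ[K] tateAlgebra K r :=
  (MvPolynomial.coeToMvPowerSeries.algHom K).codRestrict _ fun p => by
    rw [MvPolynomial.coeToMvPowerSeries.algHom_apply, Algebra.algebraMap_self,
      MvPowerSeries.map_id, RingHom.id_apply]
    exact isConvergent_coe r p

theorem ofPolynomialₐ_apply (r : Fin n → ℚ) (p : MvPolynomial (Fin n) K) :
    ofPolynomialₐ r p = ofPolynomial r p := by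
  refine Subtype.ext ?_
  simp [ofPolynomialₐ, ofPolynomial]

/-- A nonzero series has a coefficient of maximal absolute value. -/
theorem exists_max_coeff {f : tateAlgebra K (0 : Fin n → ℚ)} (hf : f ≠ 0) :
    ∃ i, coeffₗ 0 i f ≠ 0 ∧ ∀ j, Valued.v (coeffₗ 0 j f) ≤ (Valued.v (coeffₗ 0 i f) : ℤᵐ⁰) := by
  obtain ⟨i, hi⟩ : ∃ i, coeffₗ 0 i f ≠ 0 := by
    by_contra! h
    exact hf (ext_coeffₗ fun i => by rw [h, map_zero])
  -- The convergence condition is strict, so adding `1` keeps `i` itself in the finite set; indices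
  -- outside it have larger order than `i`.
  obtain ⟨j, ⟨hj, hji⟩, hmin⟩ := Set.exists_min_image _ (fun j => ord K (coeffₗ 0 j f))
    (f.2 (ord K (coeffₗ 0 i f) + 1)) ⟨i, hi, by
      rw [termVal_zero]
      exact lt_add_one _⟩
  refine ⟨j, hj, fun l => ?_⟩
  by_cases hl : coeffₗ 0 l f = 0
  · rw [hl, map_zero]
    exact zero_le
  replace hj : coeffₗ 0 j f ≠ 0 := hj
  rw [← ord_le_iff hj hl]
  by_cases h : termVal 0 (coeffₗ 0 l f) l < ord K (coeffₗ 0 i f) + 1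
  · exact hmin l ⟨hl, h⟩
  · rw [termVal_zero] at h hji
    have h1 : (ord K (coeffₗ 0 j f) : ℚ) ≤ ord K (coeffₗ 0 l f) := hji.le.trans (not_lt.1 h)
    exact_mod_cast h1

/-- All coefficients are integral. -/
def IsInt (f : tateAlgebra K (0 : Fin n → ℚ)) : Prop :=
  ∀ i, Valued.v (coeffₗ 0 i f) ≤ (1 : ℤᵐ⁰)

theorem isInt_inv_smul {f : tateAlgebra K (0 : Fin n → ℚ)} {i : Fin n →₀ ℕ}
    (hi : coeffₗ 0 i f ≠ 0)
    (hmax : ∀ j, Valued.v (coeffₗ 0 j f) ≤ (Valued.v (coeffₗ 0 i f) : ℤᵐ⁰)) :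
    IsInt ((coeffₗ 0 i f)⁻¹ • f) := by
  intro j
  rw [map_smul, smul_eq_mul, map_mul, map_inv₀]
  have hv : (Valued.v (coeffₗ 0 i f) : ℤᵐ⁰) ≠ 0 := (Valuation.ne_zero_iff _).2 hi
  calc (Valued.v (coeffₗ 0 i f) : ℤᵐ⁰)⁻¹ * Valued.v (coeffₗ 0 j f)
      ≤ (Valued.v (coeffₗ 0 i f))⁻¹ * Valued.v (coeffₗ 0 i f) := mul_le_mul_right (hmax j) _
    _ = 1 := inv_mul_cancel₀ hv

variable {J : Ideal (tateAlgebra K (0 : Fin n → ℚ))}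

theorem IsInt.mk_mem {f : tateAlgebra K (0 : Fin n → ℚ)} (hf : IsInt f) :
    Ideal.Quotient.mk J f ∈ unitBall J := by
  have h : 0 ≤ gaussVal 0 f := by
    refine le_iInf₂ fun i hi => ?_
    rw [termVal_zero]
    have : 0 ≤ ord K (MvPowerSeries.coeff i f.1) := (ord_nonneg_iff hi).2 (hf i)
    exact_mod_cast this
  exact h.trans (le_iSup₂ (f := fun g (_ : Ideal.Quotient.mk J g = Ideal.Quotient.mk J f) =>
    gaussVal 0 g) f rfl)

/-- As the valuation is discrete, the elements of the unit ball lift to integral series. -/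
theorem exists_isInt_of_mem {x : tateAlgebra K (0 : Fin n → ℚ) ⧸ J} (hx : x ∈ unitBall J) :
    ∃ f, IsInt f ∧ Ideal.Quotient.mk J f = x := by
  have hx' : 0 ≤ quotVal J x := hx
  -- The supremum defining `quotVal` is not known to be attained. A lift of Gauss valuation above
  -- `-1` exists, and its orders, being integers, are nonnegative.
  have h1 : (((-1 : ℚ) : ℝ) : EReal) < 0 := by
    norm_cast
  obtain ⟨f, hf, hlt⟩ := lt_quotVal_iff.1 (h1.trans_le hx')
  refine ⟨f, fun i => ?_, hf⟩
  by_cases hi : coeffₗ 0 i f = 0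
  · rw [hi, map_zero]
    exact zero_le
  rw [← ord_nonneg_iff hi]
  have h2 := hlt.trans_le (iInf₂_le i hi)
  rw [termVal_zero] at h2
  have h3 : (-1 : ℚ) < (ord K (MvPowerSeries.coeff i f.1) : ℚ) := by exact_mod_cast h2
  have h4 : (-1 : ℤ) < ord K (coeffₗ 0 i f) := by exact_mod_cast h3
  omega

variable {δ : ℕ} (b : Module.Basis (Fin δ) 𝒪[K] (unitBall J))

/-- Dividing by the largest coefficient leaves an integral series, so the class is an element of the
maximal ideal times an element of the unit ball. -/
theorem redCoord_eq_zero {f : tateAlgebra K (0 : Fin n → ℚ)} (hf : IsInt f)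
    (h : ∀ i, Valued.v (coeffₗ 0 i f) < (1 : ℤᵐ⁰)) :
    redCoord b ⟨Ideal.Quotient.mk J f, hf.mk_mem⟩ = 0 := by
  by_cases hf0 : f = 0
  · subst hf0
    have : (⟨Ideal.Quotient.mk J 0, hf.mk_mem⟩ : unitBall J) = 0 := Subtype.ext (map_zero _)
    rw [this, redCoord_zero]
  obtain ⟨i, hi, hmax⟩ := exists_max_coeff hf0
  set a := coeffₗ 0 i f with ha
  have hg : IsInt (a⁻¹ • f) := isInt_inv_smul hi hmax
  have hsmul : (⟨Ideal.Quotient.mk J f, hf.mk_mem⟩ : unitBall J) =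
      (⟨a, (h i).le⟩ : 𝒪[K]) • ⟨Ideal.Quotient.mk J (a⁻¹ • f), hg.mk_mem⟩ := by
    refine Subtype.ext ?_
    change Ideal.Quotient.mk J f = Ideal.Quotient.mk J (a • a⁻¹ • f)
    rw [smul_inv_smul₀ hi]
  rw [hsmul, redCoord_smul, (residue_eq_zero_iff_lt _).2 (h i), zero_smul]

/-- The monomial `X^μ` in the Tate algebra. -/
def mon (μ : Fin n →₀ ℕ) : tateAlgebra K (0 : Fin n → ℚ) :=
  ofPolynomial 0 (MvPolynomial.monomial μ 1)

theorem mon_eq (μ : Fin n →₀ ℕ) :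
    (mon μ : tateAlgebra K (0 : Fin n → ℚ)) = ofPolynomialₐ 0 (MvPolynomial.monomial μ 1) :=
  (ofPolynomialₐ_apply _ _).symm

theorem coeffₗ_mon (i μ : Fin n →₀ ℕ) :
    coeffₗ 0 i (mon μ : tateAlgebra K (0 : Fin n → ℚ)) = if μ = i then 1 else 0 := by
  classical
  rw [mon, coeffₗ_ofPolynomial, MvPolynomial.coeff_monomial]

theorem isInt_mon (μ : Fin n →₀ ℕ) : IsInt (mon μ : tateAlgebra K (0 : Fin n → ℚ)) := by
  intro i
  rw [coeffₗ_mon]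
  split_ifs <;> simp

/-- The class of a monomial in the unit ball. -/
def monClass (J : Ideal (tateAlgebra K (0 : Fin n → ℚ))) (μ : Fin n →₀ ℕ) :
    unitBall J :=
  ⟨Ideal.Quotient.mk J (mon μ), (isInt_mon μ).mk_mem⟩

/-- Modulo the maximal ideal, the coordinates of an integral series are those of its reduction,
a polynomial. -/
theorem redCoord_eq_sum {f : tateAlgebra K (0 : Fin n → ℚ)} (hf : IsInt f)
    {s : Finset (Fin n →₀ ℕ)} (hs : ∀ i ∉ s, Valued.v (coeffₗ 0 i f) < (1 : ℤᵐ⁰)) :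
    redCoord b ⟨Ideal.Quotient.mk J f, hf.mk_mem⟩ =
      ∑ i ∈ s, IsLocalRing.residue 𝒪[K] ⟨coeffₗ 0 i f, hf i⟩ • redCoord b (monClass J i) := by
  set g := f - ∑ i ∈ s, coeffₗ 0 i f • mon i with hg
  have hcoeff : ∀ j, Valued.v (coeffₗ 0 j g) < (1 : ℤᵐ⁰) := by
    intro j
    rw [hg, map_sub, map_sum]
    simp only [map_smul, coeffₗ_mon, smul_eq_mul, mul_ite, mul_one, mul_zero,
      Finset.sum_ite_eq']
    split_ifs with h
    · simp
    · rw [sub_zero]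
      exact hs j h
  have hgi : IsInt g := fun j => (hcoeff j).le
  have hsum : (⟨Ideal.Quotient.mk J f, hf.mk_mem⟩ : unitBall J) =
      ⟨Ideal.Quotient.mk J g, hgi.mk_mem⟩ +
        ∑ i ∈ s, (⟨coeffₗ 0 i f, hf i⟩ : 𝒪[K]) • monClass J i := by
    refine Subtype.ext ?_
    rw [Submodule.coe_add, Submodule.coe_sum]
    change _ = Ideal.Quotient.mk J g +
      ∑ i ∈ s, Ideal.Quotient.mk J (coeffₗ 0 i f • mon i)
    rw [← map_sum, ← map_add, hg, sub_add_cancel]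
  rw [hsum, redCoord_add_sum_smul, redCoord_eq_zero b hgi hcoeff, zero_add]

theorem finite_setOf_coeff_eq_one {f : tateAlgebra K (0 : Fin n → ℚ)} :
    {i | ¬ Valued.v (coeffₗ 0 i f) < (1 : ℤᵐ⁰)}.Finite := by
  refine (f.2 1).subset fun i hi => ?_
  have h0 : coeffₗ 0 i f ≠ 0 := by
    rintro h
    simp [h] at hi
  refine ⟨h0, ?_⟩
  rw [termVal_zero]
  have h1 : Valued.v (1 : K) ≤ (Valued.v (coeffₗ 0 i f) : ℤᵐ⁰) := by
    rw [map_one]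
    exact not_lt.1 hi
  rw [← ord_le_iff h0 one_ne_zero, ord_one] at h1
  have h2 : (ord K (coeffₗ 0 i f) : ℚ) ≤ 0 := by exact_mod_cast h1
  exact h2.trans_lt one_pos

/-- The reductions of the coordinates of the monomials span. -/
theorem span_redCoord_eq_top :
    Submodule.span 𝓀[K] (Set.range fun μ => redCoord b (monClass J μ)) = ⊤ := by
  refine top_le_iff.1 fun x _ => ?_
  obtain ⟨y, rfl⟩ := exists_redCoord_eq b x
  obtain ⟨f, hf, hfx⟩ := exists_isInt_of_mem y.2
  have hx : y = ⟨Ideal.Quotient.mk J f, hf.mk_mem⟩ := Subtype.ext hfx.symm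
  rw [hx, redCoord_eq_sum b hf (s := finite_setOf_coeff_eq_one.toFinset)
    fun i hi => by simpa using hi]
  exact Submodule.sum_mem _ fun i _ => Submodule.smul_mem _ _ (Submodule.subset_span ⟨i, rfl⟩)

end Tate

/-! ### Relations between monomials, and coordinates in a basis of a submodule. -/

section Output

open Counted

variable {n d : ℕ}

/-- The largest monomial of a relation is a multiple of a leading monomial. -/
theorem FGLMSpec.exists_lead_le {k : Type*} [Field k] {m : MonomialOrder (Fin n)}
    {U : Fin n → Fin d → Fin d → k} {w : Fin d → k} {c : (Fin n →₀ ℕ) → Fin d → k}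
    (hc : IsCoord U w c) {G : List (MonicPoly k n)} {β : Fin d → Fin n →₀ ℕ}
    (h : FGLMSpec m c G (List.ofFn β)) (hβ : LinearIndependent k fun j => c (β j))
    {s : Finset (Fin n →₀ ℕ)} {a : (Fin n →₀ ℕ) → k} (hsum : ∑ i ∈ s, a i • c i = 0)
    {j : Fin n →₀ ℕ} (hj : j ∈ s) (haj : a j ≠ 0)
    (hmax : ∀ i ∈ s, m.toSyn i ≤ m.toSyn j) : ∃ g ∈ G, g.lead ≤ j := by
  classical
  -- If `j` were in the staircase, the relation would express its coordinates through those of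
  -- smaller monomials, hence of smaller staircase members, against independence.
  refine (h.cover j).resolve_left fun hjB => ?_
  obtain ⟨t, rfl⟩ := List.mem_ofFn.1 hjB
  have hnot : t ∉ {i : Fin d | m.toSyn (β i) < m.toSyn (β t)} := by simp
  refine hβ.notMem_span_image hnot ?_
  rw [← Finset.add_sum_erase s _ hj] at hsum
  refine (Submodule.smul_mem_iff _ haj).1 ?_
  rw [eq_neg_of_add_eq_zero_left hsum]
  refine Submodule.neg_mem _ (Submodule.sum_mem _ fun i hi => Submodule.smul_mem _ _ ?_)
  obtain ⟨hit, his⟩ := Finset.mem_erase.1 hi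
  have hlt : m.toSyn i < m.toSyn (β t) :=
    lt_of_le_of_ne (hmax i his) fun h' => hit (m.toSyn.injective h')
  refine Submodule.span_mono ?_ (mem_span_of_isCovered hc h.leads h.cover i)
  rintro _ ⟨γ, ⟨hγ, hle⟩, rfl⟩
  obtain ⟨l, rfl⟩ := List.mem_ofFn.1 hγ
  exact ⟨l, hle.trans_lt hlt, rfl⟩

theorem toMvPolynomial_mk' {k : Type*} [Field k] (μ : Fin n →₀ ℕ) (β : Fin d → Fin n →₀ ℕ)
    (e : Fin d → k) : (MonicPoly.mk' μ (List.ofFn β) e).toMvPolynomial =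
      MvPolynomial.monomial μ 1 + ∑ j, MvPolynomial.monomial (β j) (e j) := by
  have hzip : (List.ofFn β).zip (List.ofFn e) = List.ofFn fun j => (β j, e j) := by
    refine List.ext_getElem (by simp) fun i h1 h2 => by simp
  rw [MonicPoly.toMvPolynomial, MonicPoly.mk', hzip, List.map_ofFn, List.sum_ofFn]
  rfl

/-- Coordinates in a basis of a submodule. -/
theorem equivFun_eq_of_coe_eq {R A : Type*} [CommRing R] [AddCommMonoid A] [Module R A]
    {D : Submodule R A} (b : Module.Basis (Fin d) R D) {x : D} {a : Fin d → R}
    (h : (x : A) = ∑ k, a k • (b k : A)) : b.equivFun x = a := by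
  have : x = ∑ k, a k • b k := by
    refine Subtype.ext ?_
    rw [h, Submodule.coe_sum]
    rfl
  rw [this, ← Module.Basis.equivFun_symm_apply, LinearEquiv.apply_symm_apply]

/-- The multiplications act on the ambient module `A`, because `D` is only a submodule; it is enough
that the vectors `y μ` lie in `D`. -/
theorem isCoord_equivFun {R A : Type*} [CommRing R] [AddCommMonoid A] [Module R A]
    {D : Submodule R A} (b : Module.Basis (Fin d) R D) {x : Fin n → A →ₗ[R] A} {e : A}
    {U : Fin n → Fin d → Fin d → R} {w : Fin d → R} {y : (Fin n →₀ ℕ) → D}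
    (hU : ∀ i l, x i (b l : A) = ∑ k, U i k l • (b k : A))
    (hw : e = ∑ k, w k • (b k : A)) (h0 : (y 0 : A) = e)
    (hy : ∀ i μ, (y (μ + Finsupp.single i 1) : A) = x i (y μ)) :
    IsCoord U w fun μ => b.equivFun (y μ) where
  zero := equivFun_eq_of_coe_eq b (h0.trans hw)
  add_single i μ := by
    refine equivFun_eq_of_coe_eq b ?_
    have h1 : (y μ : A) = ∑ l, b.equivFun (y μ) l • (b l : A) := by
      conv_lhs => rw [← b.sum_equivFun (y μ)]
      rw [Submodule.coe_sum]
      rfl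
    rw [hy, h1, map_sum]
    simp only [map_smul, hU, Finset.smul_sum, Finset.sum_smul, smul_smul]
    rw [Finset.sum_comm]
    refine Finset.sum_congr rfl fun k _ => Finset.sum_congr rfl fun l _ => ?_
    rw [mul_comm]

theorem add_sum_smul_eq_zero {R M : Type*} [CommRing R] [AddCommGroup M] [Module R M]
    (b : Module.Basis (Fin d) R M) {ι : Type*} [Fintype ι] {x : M} {y : ι → M} {q : ι → R}
    (h : b.equivFun x + ∑ j, q j • b.equivFun (y j) = 0) : x + ∑ j, q j • y j = 0 := by
  refine b.equivFun.injective ?_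
  rw [map_add, map_sum, map_zero, ← h]
  simp only [map_smul]

end Output

/-! ### Leading terms of series, and membership of the output in `J`. -/

section Tate

variable {K : Type*} [Field K] [Valued K ℤᵐ⁰] {n : ℕ}
  {J : Ideal (tateAlgebra K (0 : Fin n → ℚ))} {δ : ℕ}

theorem monClass_zero : (monClass J 0 : tateAlgebra K (0 : Fin n → ℚ) ⧸ J) = 1 := by
  change Ideal.Quotient.mk J (mon 0) = 1
  rw [mon_eq]
  change Ideal.Quotient.mk J (ofPolynomialₐ 0 1) = 1
  rw [map_one, map_one]

theorem monClass_add_single (i : Fin n) (μ : Fin n →₀ ℕ) :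
    (monClass J (μ + Finsupp.single i 1) : tateAlgebra K (0 : Fin n → ℚ) ⧸ J) =
      Ideal.Quotient.mk J (ofPolynomial 0 (MvPolynomial.X i)) * monClass J μ := by
  change Ideal.Quotient.mk J (mon _) = _ * Ideal.Quotient.mk J (mon _)
  rw [← map_mul, mon_eq, mon_eq, ← ofPolynomialₐ_apply, ← map_mul, MvPolynomial.X,
    MvPolynomial.monomial_mul, one_mul, add_comm]

/-- The leading monomial of a series all of whose coefficients are bounded by that of `i`. -/
theorem exists_isLeadingMonomial (m : MonomialOrder (Fin n))
    {f : tateAlgebra K (0 : Fin n → ℚ)} {i : Fin n →₀ ℕ} (hi : coeffₗ 0 i f ≠ 0)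
    (hmax : ∀ j, Valued.v (coeffₗ 0 j f) ≤ (Valued.v (coeffₗ 0 i f) : ℤᵐ⁰))
    {s : Finset (Fin n →₀ ℕ)}
    (hs : ∀ l, l ∈ s ↔ Valued.v (coeffₗ 0 l f) = (Valued.v (coeffₗ 0 i f) : ℤᵐ⁰)) :
    ∃ j ∈ s, IsLeadingMonomial m f j ∧ ∀ l ∈ s, m.toSyn l ≤ m.toSyn j := by
  obtain ⟨j, hj, hle⟩ := s.exists_max_image m.toSyn ⟨i, (hs i).2 rfl⟩
  have hvj := (hs j).1 hj
  have hj0 : coeffₗ 0 j f ≠ 0 := by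
    rw [← Valuation.ne_zero_iff (Valued.v : Valuation K ℤᵐ⁰), hvj, Valuation.ne_zero_iff]
    exact hi
  refine ⟨j, hj, ⟨hj0, fun l (hl : coeffₗ 0 l f ≠ 0) hlj => ?_⟩, hle⟩
  rw [TermLT, termVal_zero, termVal_zero, Int.cast_lt, Int.cast_inj]
  change ord K (coeffₗ 0 j f) < ord K (coeffₗ 0 l f) ∨
    (ord K (coeffₗ 0 l f) = ord K (coeffₗ 0 j f) ∧ _)
  rcases (hmax l).lt_or_eq with h | h
  · left
    rw [ord_lt_iff hj0 hl, hvj]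
    exact h
  · right
    refine ⟨?_, lt_of_le_of_ne (hle l ((hs l).2 h)) fun h' => hlj (m.toSyn.injective h')⟩
    rw [ord, ord, h, hvj]

/-- A monic polynomial with integral tail whose reduction has the same leading monomial. -/
theorem isLeadingMonomial_mk' (m : MonomialOrder (Fin n)) {μ : Fin n →₀ ℕ}
    {β : Fin δ → Fin n →₀ ℕ} (hβ : Function.Injective β) (hμ : μ ∉ List.ofFn β) {q : Fin δ → 𝒪[K]}
    (hq : ∀ j, ¬ m.toSyn (β j) < m.toSyn μ → IsLocalRing.residue 𝒪[K] (q j) = 0) :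
    IsLeadingMonomial m (ofPolynomial (0 : Fin n → ℚ)
      (MonicPoly.mk' μ (List.ofFn β) fun j => (q j : K)).toMvPolynomial) μ := by
  classical
  have hcoeff : ∀ ν, coeffₗ 0 ν (ofPolynomial (0 : Fin n → ℚ)
      (MonicPoly.mk' μ (List.ofFn β) fun j => (q j : K)).toMvPolynomial) =
      (if μ = ν then 1 else 0) + ∑ j, if β j = ν then (q j : K) else 0 := by
    intro ν
    rw [coeffₗ_ofPolynomial, toMvPolynomial_mk', MvPolynomial.coeff_add, MvPolynomial.coeff_sum]
    simp only [MvPolynomial.coeff_monomial]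
  have hlead : coeffₗ 0 μ (ofPolynomial (0 : Fin n → ℚ)
      (MonicPoly.mk' μ (List.ofFn β) fun j => (q j : K)).toMvPolynomial) = 1 := by
    rw [hcoeff, if_pos rfl, Finset.sum_eq_zero, add_zero]
    exact fun j _ => if_neg fun h => hμ (List.mem_ofFn.2 ⟨j, h⟩)
  refine ⟨?_, fun ν hν hνμ => ?_⟩
  · rw [← coeffₗ_apply, hlead]
    exact one_ne_zero
  · rw [← coeffₗ_apply, ← coeffₗ_apply, hlead, TermLT, termVal_zero, termVal_zero, ord_one,
      Int.cast_lt, Int.cast_inj]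
    rw [← coeffₗ_apply] at hν
    obtain ⟨j, rfl⟩ : ∃ j, β j = ν := by
      by_contra! h
      refine hν ?_
      rw [hcoeff, if_neg hνμ.symm, zero_add]
      exact Finset.sum_eq_zero fun j _ => if_neg (h j)
    have hj : coeffₗ 0 (β j) (ofPolynomial (0 : Fin n → ℚ)
      (MonicPoly.mk' μ (List.ofFn β) fun j => (q j : K)).toMvPolynomial) = q j := by
      rw [hcoeff, if_neg hνμ.symm, zero_add, Finset.sum_eq_single j]
      · exact if_pos rfl
      · exact fun i _ hij => if_neg fun h => hij (hβ h)
      · simp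
    rw [hj] at hν ⊢
    -- The coefficient at `μ` is `1`, of order `0`. A tail term at a smaller monomial has order at
    -- least `0` and loses a tie; any other tail term has positive order.
    by_cases hlt : m.toSyn (β j) < m.toSyn μ
    · have h0 : 0 ≤ ord K (q j : K) := (ord_nonneg_iff hν).2 (q j).2
      rcases h0.lt_or_eq with h | h
      · exact Or.inl h
      · exact Or.inr ⟨h.symm, hlt⟩
    · left
      rw [← ord_one (K := K), ord_lt_iff one_ne_zero hν, map_one]
      exact (residue_eq_zero_iff_lt _).1 (hq j hlt)

theorem ofPolynomial_mk'_mem {μ : Fin n →₀ ℕ} {β : Fin δ → Fin n →₀ ℕ} {q : Fin δ → 𝒪[K]}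
    (h : monClass J μ + ∑ j, q j • monClass J (β j) = 0) :
    ofPolynomial (0 : Fin n → ℚ)
      (MonicPoly.mk' μ (List.ofFn β) fun j => (q j : K)).toMvPolynomial ∈ J := by
  have hp : ofPolynomial (0 : Fin n → ℚ)
      (MonicPoly.mk' μ (List.ofFn β) fun j => (q j : K)).toMvPolynomial =
      mon μ + ∑ j, (q j : K) • mon (β j) := by
    rw [toMvPolynomial_mk', ← ofPolynomialₐ_apply, map_add, map_sum, mon_eq]
    congr 1
    refine Finset.sum_congr rfl fun j _ => ?_
    rw [mon_eq, ← map_smul, MvPolynomial.smul_monomial, smul_eq_mul, mul_one]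
  rw [← Ideal.Quotient.eq_zero_iff_mem, hp, map_add, map_sum]
  have h1 := congrArg (Subtype.val) h
  rw [Submodule.coe_add, Submodule.coe_sum] at h1
  exact h1

end Tate

/-! ### Correctness of `algorithmGB` and its operation count. -/

section Main

variable {K : Type*} [Field K] [Valued K ℤᵐ⁰] {n : ℕ}
  {J : Ideal (tateAlgebra K (0 : Fin n → ℚ))} {δ : ℕ}

/-- A basis of the unit ball is a basis of the whole quotient. -/
theorem finrank_quotient (b : Module.Basis (Fin δ) 𝒪[K] (unitBall J)) :
    Module.finrank K (tateAlgebra K (0 : Fin n → ℚ) ⧸ J) = δ := by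
  have hli : LinearIndependent 𝒪[K]
      fun k => (b k : tateAlgebra K (0 : Fin n → ℚ) ⧸ J) :=
    b.linearIndependent.map' (unitBall J).subtype (Submodule.ker_subtype _)
  -- Denominators can be cleared in a relation over `K`, so independence over `K°` is enough;
  -- spanning follows by scaling a lift to be integral.
  rw [LinearIndependent.iff_fractionRing 𝒪[K] K] at hli
  have hspan : ⊤ ≤ Submodule.span K
      (Set.range fun k => (b k : tateAlgebra K (0 : Fin n → ℚ) ⧸ J)) := by
    rintro x -
    obtain ⟨f, rfl⟩ := Ideal.Quotient.mk_surjective x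
    by_cases hf : f = 0
    · rw [hf, map_zero]
      exact Submodule.zero_mem _
    obtain ⟨i, hi, hmax⟩ := exists_max_coeff hf
    have hx : Ideal.Quotient.mk J f =
        coeffₗ 0 i f • Ideal.Quotient.mk J ((coeffₗ 0 i f)⁻¹ • f) := by
      change _ = Ideal.Quotient.mk J (coeffₗ 0 i f • (coeffₗ 0 i f)⁻¹ • f)
      rw [smul_inv_smul₀ hi]
    rw [hx]
    refine Submodule.smul_mem _ _ ?_
    have h1 := congrArg Subtype.val
      (b.sum_equivFun ⟨_, (isInt_inv_smul hi hmax).mk_mem (J := J)⟩)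
    rw [Submodule.coe_sum] at h1
    change _ = Ideal.Quotient.mk J ((coeffₗ 0 i f)⁻¹ • f) at h1
    rw [← h1]
    refine Submodule.sum_mem _ fun k _ => ?_
    exact Submodule.smul_mem _ (_ : K) (Submodule.subset_span ⟨k, rfl⟩)
  rw [Module.finrank_eq_card_basis (Module.Basis.mk hli hspan), Fintype.card_fin]

open Counted

/-- The output of the algorithm, in terms of the output of the algorithm FGLM over the residue
field. -/
theorem val_algorithmGB {c : (Fin n →₀ ℕ) → Fin δ → 𝒪[K]} {m : MonomialOrder (Fin n)}
    {U : Fin n → Fin δ → Fin δ → 𝒪[K]} {w : Fin δ → 𝒪[K]} (hc : IsCoord U w c)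
    {G : List (MonicPoly 𝓀[K] n)} {β : Fin δ → Fin n →₀ ℕ}
    (hGB : (fglmField m (Arith.ofField 𝓀[K])
      (fun i a b => IsLocalRing.residue 𝒪[K] (U i a b))
      (fun a => IsLocalRing.residue 𝒪[K] (w a))).val = (G, List.ofFn β))
    (hspec : FGLMSpec m (fun μ a => IsLocalRing.residue 𝒪[K] (c μ a)) G (List.ofFn β))
    (hβ : LinearIndependent 𝓀[K] fun j a => IsLocalRing.residue 𝒪[K] (c (β j) a)) :
    ∃ q : MonicPoly 𝓀[K] n → Fin δ → 𝒪[K],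
      (algorithmGB (LocalArith.ofValued K) m U w).val =
        G.map (fun g => MonicPoly.mk' g.lead (List.ofFn β) fun j => (q g j : K)) ∧
      ∀ g ∈ G, c g.lead + ∑ j, q g j • c (β j) = 0 ∧
        ∀ j, ¬ m.toSyn (β j) < m.toSyn g.lead → IsLocalRing.residue 𝒪[K] (q g j) = 0 := by
  have hcK := hc.map (algebraMap 𝒪[K] K)
  have hT := val_monomialTable hcK hspec.chain
  have hfst : ((List.ofFn β).map fun μ => (μ, fun a => algebraMap 𝒪[K] K (c μ a))).map Prod.fst =
      List.ofFn β := by simp [Function.comp_def]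
  have hsnd : ((List.ofFn β).map fun μ => (μ, fun a => algebraMap 𝒪[K] K (c μ a))).map Prod.snd =
      List.ofFn fun j a => algebraMap 𝒪[K] K (c (β j) a) := by
    rw [List.map_map, List.map_ofFn]
    rfl
  set M := (List.ofFn β).map fun μ => (μ, fun a => algebraMap 𝒪[K] K (c μ a)) with hM
  have hech := isEchelon_echelon_ofFn (exists_integral_coord (K := K) hβ).1
  set rows := (echelon (Arith.ofField K)
    (List.ofFn fun j a => algebraMap 𝒪[K] K (c (β j) a))).val with hrows
  have hval : (algorithmGB (LocalArith.ofValued K) m U w).val = G.map fun g =>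
      MonicPoly.mk' g.lead (List.ofFn β) (reduce (Arith.ofField K) rows
        (monomialVec (Arith.ofField K) (fun i a b => algebraMap 𝒪[K] K (U i a b))
          (fun a => algebraMap 𝒪[K] K (w a)) M g.lead).val).val.2 := by
    rw [hrows, ← hsnd, ← hT]
    have h1 := congrArg Prod.fst hGB
    have h2 := congrArg Prod.snd hGB
    simp only at h1 h2
    rw [← h1, ← h2]
    exact val_mapList _ _
  -- The membership condition is put inside the existential so that `choose` gives a total function;
  -- its value outside `G` is irrelevant.
  have hrel : ∀ g : MonicPoly 𝓀[K] n, ∃ q : Fin δ → 𝒪[K], g ∈ G →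
      (reduce (Arith.ofField K) rows
        (monomialVec (Arith.ofField K) (fun i a b => algebraMap 𝒪[K] K (U i a b))
          (fun a => algebraMap 𝒪[K] K (w a)) M g.lead).val).val.2 = (fun j => (q j : K)) ∧
      c g.lead + ∑ j, q j • c (β j) = 0 ∧
        ∀ j, ¬ m.toSyn (β j) < m.toSyn g.lead → IsLocalRing.residue 𝒪[K] (q j) = 0 := by
    intro g
    by_cases hg : g ∈ G
    · have hv := val_monomialVec hcK (T := M) (μ := g.lead) (by
        intro p hp
        obtain ⟨μ, -, rfl⟩ := List.mem_map.1 hp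
        rfl) (by
        rw [hfst]
        exact hspec.leads.next g hg)
      rw [hv]
      obtain ⟨q, h1, h2, h3⟩ := exists_integral_relation hspec.leads hβ hg
        (hech.add_famSum_reduce (List.length_ofFn) _)
      exact ⟨q, fun _ => ⟨funext h1, h2, h3⟩⟩
    · exact ⟨0, fun h => absurd h hg⟩
  choose q hq using hrel
  refine ⟨q, ?_, fun g hg => (hq g hg).2⟩
  rw [hval]
  refine List.map_congr_left fun g hg => ?_
  rw [(hq g hg).1]

theorem ops_algorithmGB_le {c : (Fin n →₀ ℕ) → Fin δ → 𝒪[K]} (m : MonomialOrder (Fin n))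
    {U : Fin n → Fin δ → Fin δ → 𝒪[K]} {w : Fin δ → 𝒪[K]} (hc : IsCoord U w c) (hn : 0 < n) :
    (algorithmGB (LocalArith.ofValued K) m U w).ops ≤ 43 * (n * δ ^ 3) := by
  obtain ⟨hspec, hops⟩ := fglmField_spec (m := m) (hc.map (IsLocalRing.residue 𝒪[K]))
  set GB := fglmField m (Arith.ofField 𝓀[K]) (fun i a b => IsLocalRing.residue 𝒪[K] (U i a b))
    (fun a => IsLocalRing.residue 𝒪[K] (w a)) with hGB
  set T := monomialTable (Arith.ofField K) (fun i a b => (U i a b : K)) (fun a => (w a : K))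
    GB.val.2 with hT
  set E := echelon (Arith.ofField K) (T.val.map Prod.snd) with hE
  set L := mapList (fun g : MonicPoly 𝓀[K] n =>
    (monomialVec (Arith.ofField K) (fun i a b => (U i a b : K)) (fun a => (w a : K))
      T.val g.lead).bind fun v => (reduce (Arith.ofField K) E.val v).bind fun p =>
        Counted.pure (MonicPoly.mk' g.lead GB.val.2 p.2)) GB.val.1 with hL
  have hsplit : (algorithmGB (LocalArith.ofValued K) m U w).ops =
      (Counted.vec fun i => Counted.vec fun a => Counted.vec fun b =>
        (LocalArith.ofValued K).residue (U i a b)).ops +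
      ((Counted.vec fun a => (LocalArith.ofValued K).residue (w a)).ops +
      (GB.ops + ((Counted.vec fun i => Counted.vec fun a => Counted.vec fun b =>
        (LocalArith.ofValued K).incl (U i a b)).ops +
      ((Counted.vec fun a => (LocalArith.ofValued K).incl (w a)).ops +
      (T.ops + (E.ops + L.ops)))))) := rfl
  have h1 : (Counted.vec fun i => Counted.vec fun a => Counted.vec fun b =>
      (LocalArith.ofValued K).residue (U i a b)).ops ≤ n * (δ * (δ * 1)) :=
    ops_vec_le fun i => ops_vec_le fun a => ops_vec_le fun b => le_rfl
  have h2 : (Counted.vec fun a => (LocalArith.ofValued K).residue (w a)).ops ≤ δ * 1 :=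
    ops_vec_le fun a => le_rfl
  have h3 : (Counted.vec fun i => Counted.vec fun a => Counted.vec fun b =>
      (LocalArith.ofValued K).incl (U i a b)).ops ≤ n * (δ * (δ * 1)) :=
    ops_vec_le fun i => ops_vec_le fun a => ops_vec_le fun b => le_rfl
  have h4 : (Counted.vec fun a => (LocalArith.ofValued K).incl (w a)).ops ≤ δ * 1 :=
    ops_vec_le fun a => le_rfl
  have hTlen : (T.val.map Prod.snd).length ≤ δ := by
    have hTval := val_monomialTable (hc.map (algebraMap 𝒪[K] K)) hspec.chain
    have : T.val.length = GB.val.2.length := by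
      rw [← List.length_map (as := GB.val.2)
        fun μ => (μ, fun a => algebraMap 𝒪[K] K (c μ a)), ← hTval]
      rfl
    rw [List.length_map, this]
    exact hspec.length_le
  have h5 : T.ops ≤ δ * (2 * δ ^ 2) :=
    (ops_monomialTable_le _ _ _).trans (Nat.mul_le_mul_right _ hspec.length_le)
  obtain ⟨hElen, hEops⟩ := length_ops_echelon_le hTlen
  have h6 : E.ops ≤ δ * (7 * δ ^ 2) := hEops.trans (Nat.mul_le_mul_right _ hTlen)
  have h7 : L.ops ≤ (n * δ + 1) * (6 * δ ^ 2) := by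
    refine (ops_mapList_le (c := 6 * δ ^ 2) (fun g => ?_) _).trans
      (Nat.mul_le_mul_right _ hspec.basis_length)
    have h8 := ops_monomialVec_le (fun i a b => (U i a b : K)) (fun a => (w a : K)) T.val g.lead
    have h9 := ops_reduce_le E.val (monomialVec (Arith.ofField K) (fun i a b => (U i a b : K))
      (fun a => (w a : K)) T.val g.lead).val
    have h10 : E.val.length * (δ * 4) ≤ δ * (δ * 4) :=
      Nat.mul_le_mul_right _ (hElen.trans hTlen)
    simp only [ops_bind, ops_pure]
    nlinarith
  rw [hsplit]
  have hle : δ ^ 2 ≤ δ ^ 3 := by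
    rcases Nat.eq_zero_or_pos δ with h0 | h0
    · simp [h0]
    · exact Nat.pow_le_pow_right h0 (by norm_num)
  have e1 : n * (δ * (δ * 1)) ≤ n * δ ^ 3 :=
    Nat.mul_le_mul_left n ((by ring : δ * (δ * 1) = δ ^ 2).trans_le hle)
  have e2 : δ ≤ δ ^ 3 := Nat.le_self_pow three_ne_zero δ
  -- Positivity of `n` absorbs the terms without a factor `n`.
  have e3 : δ ^ 3 ≤ n * δ ^ 3 := Nat.le_mul_of_pos_left _ hn
  have e4 : (n * δ + 1) * (9 * δ ^ 2) = 9 * (n * δ ^ 3) + 9 * δ ^ 2 := by ring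
  have e5 : (n * δ + 1) * (6 * δ ^ 2) = 6 * (n * δ ^ 3) + 6 * δ ^ 2 := by ring
  have e6 : δ * (2 * δ ^ 2) = 2 * δ ^ 3 := by ring
  have e7 : δ * (7 * δ ^ 2) = 7 * δ ^ 3 := by ring
  -- The constant is `43 = 2 + 2 + 18 + 2 + 7 + 12`: conversions of the matrices, conversions of
  -- `w`, FGLM, the table `M`, its echelon form, and the final reductions.
  omega

/-- Multiplication by an element of the quotient, as a linear map over the valuation ring. -/
def mulQuot (g : tateAlgebra K (0 : Fin n → ℚ)) :
    (tateAlgebra K (0 : Fin n → ℚ) ⧸ J) →ₗ[𝒪[K]] (tateAlgebra K (0 : Fin n → ℚ) ⧸ J) where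
  toFun x := Ideal.Quotient.mk J g * x
  map_add' := mul_add _
  map_smul' a x := by
    obtain ⟨f, rfl⟩ := Ideal.Quotient.mk_surjective x
    change Ideal.Quotient.mk J (g * ((a : K) • f)) = Ideal.Quotient.mk J ((a : K) • (g * f))
    rw [mul_smul_comm]

theorem isCoord_monClass (b : Module.Basis (Fin δ) 𝒪[K] (unitBall J))
    {U : Fin n → Fin δ → Fin δ → 𝒪[K]} {w : Fin δ → 𝒪[K]}
    (hU : ∀ i l, Ideal.Quotient.mk J (ofPolynomial 0 (MvPolynomial.X i)) *
      (b l : tateAlgebra K (0 : Fin n → ℚ) ⧸ J) =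
        ∑ k, U i k l • (b k : tateAlgebra K (0 : Fin n → ℚ) ⧸ J))
    (hw : (1 : tateAlgebra K (0 : Fin n → ℚ) ⧸ J) =
      ∑ k, w k • (b k : tateAlgebra K (0 : Fin n → ℚ) ⧸ J)) :
    IsCoord U w fun μ => b.equivFun (monClass J μ) :=
  isCoord_equivFun (D := unitBall J) b (x := fun i => mulQuot (ofPolynomial 0 (MvPolynomial.X i)))
    hU hw monClass_zero monClass_add_single

theorem isGroebnerBasis_algorithmGB (m : MonomialOrder (Fin n))
    (b : Module.Basis (Fin δ) 𝒪[K] (unitBall J))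
    {U : Fin n → Fin δ → Fin δ → 𝒪[K]} {w : Fin δ → 𝒪[K]}
    (hc : IsCoord U w fun μ => b.equivFun (monClass J μ)) :
    IsGroebnerBasis m J ((algorithmGB (LocalArith.ofValued K) m U w).val.map
      fun g => ofPolynomial 0 g.toMvPolynomial) := by
  have hck := hc.map (IsLocalRing.residue 𝒪[K])
  obtain ⟨hspec, -⟩ := fglmField_spec (m := m) hck
  obtain ⟨β, hB, hβ⟩ := hspec.exists_basis hck (span_redCoord_eq_top b)
  rw [hB] at hspec
  obtain ⟨q, hval, hq⟩ := val_algorithmGB hc (Prod.ext rfl hB) hspec hβ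
  have hinj : Function.Injective β := fun i j hij => hβ.injective (by simp only [hij])
  rw [hval]
  constructor
  · intro p hp
    simp only [List.map_map, List.mem_map, Function.comp_apply] at hp
    obtain ⟨g, hg, rfl⟩ := hp
    exact ofPolynomial_mk'_mem (add_sum_smul_eq_zero b (hq g hg).1)
  · intro f hfJ hf0
    obtain ⟨i, hi, hmax⟩ := exists_max_coeff hf0
    set f' := (coeffₗ 0 i f)⁻¹ • f with hf'
    have hint : IsInt f' := isInt_inv_smul hi hmax
    have hv : (Valued.v (coeffₗ 0 i f) : ℤᵐ⁰) ≠ 0 := (Valuation.ne_zero_iff _).2 hi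
    have hcoeff : ∀ l, Valued.v (coeffₗ 0 l f') =
        (Valued.v (coeffₗ 0 i f) : ℤᵐ⁰)⁻¹ * Valued.v (coeffₗ 0 l f) := by
      intro l
      rw [hf', map_smul, smul_eq_mul, map_mul, map_inv₀]
    have hfin := finite_setOf_coeff_eq_one (f := f')
    -- The monomials surviving in the reduction of `f'` are those where `f` has a coefficient of
    -- maximal absolute value; the largest of them is the leading monomial of `f`.
    have hiff : ∀ l, ¬ Valued.v (coeffₗ 0 l f') < (1 : ℤᵐ⁰) ↔
        Valued.v (coeffₗ 0 l f) = (Valued.v (coeffₗ 0 i f) : ℤᵐ⁰) := by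
      intro l
      rw [lt_iff_le_and_ne, not_and, not_not, hcoeff, inv_mul_eq_one₀ hv, eq_comm, ← hcoeff]
      exact ⟨fun h => h (hint l), fun h _ => h⟩
    obtain ⟨j, hj, hlead, hle⟩ := exists_isLeadingMonomial m hi hmax (s := hfin.toFinset)
      fun l => by rw [Set.Finite.mem_toFinset, Set.mem_ofPred_eq, hiff]
    -- Since `f'` is in `J`, its reduction is a relation between the reduced coordinates of the
    -- surviving monomials.
    have hzero : redCoord b ⟨Ideal.Quotient.mk J f', hint.mk_mem⟩ = 0 := by
      have : (⟨Ideal.Quotient.mk J f', hint.mk_mem⟩ : unitBall J) = 0 := by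
        refine Subtype.ext (Ideal.Quotient.eq_zero_iff_mem.2 ?_)
        rw [hf', Algebra.smul_def]
        exact Ideal.mul_mem_left _ _ hfJ
      rw [this, redCoord_zero]
    rw [redCoord_eq_sum b hint (s := hfin.toFinset) fun l hl => by simpa using hl] at hzero
    obtain ⟨g, hg, hgj⟩ := hspec.exists_lead_le hck hβ
      (a := fun l => IsLocalRing.residue 𝒪[K] ⟨coeffₗ 0 l f', hint l⟩) hzero hj
      (by
        rw [Ne, residue_eq_zero_iff_lt]
        simpa using hj) hle
    refine ⟨_, List.mem_map_of_mem (List.mem_map_of_mem hg), g.lead, j, ?_, hlead, hgj⟩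
    exact isLeadingMonomial_mk' m hinj (hspec.leads.notMem g hg) (hq g hg).2

end Main

end TateFGLM

end

theorem mainTheorem7 :
    ∃ C : ℕ,
      ∀ (K : Type*) [Field K] [Valued K ℤᵐ⁰] [CompleteSpace K]
        [(Valued.v : Valuation K ℤᵐ⁰).IsRankOneDiscrete]
        (n : ℕ) (m : MonomialOrder (Fin n))
        (r : Fin n → ℚ) (hr : 0 ≤ r)
        (I : Ideal (tateAlgebra K r)) (_hI : FiniteDimensional K (tateAlgebra K r ⧸ I))
        (J : Ideal (tateAlgebra K (0 : Fin n → ℚ))) (_hJ : J = extendIdeal hr I)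
        (δ : ℕ) (b : Module.Basis (Fin δ) 𝒪[K] (unitBall J))
        (U : Fin n → Fin δ → Fin δ → 𝒪[K]) (w : Fin δ → 𝒪[K])
        (_hU : ∀ i l, Ideal.Quotient.mk J (ofPolynomial 0 (MvPolynomial.X i)) *
          (b l : tateAlgebra K (0 : Fin n → ℚ) ⧸ J) =
            ∑ k, U i k l • (b k : tateAlgebra K (0 : Fin n → ℚ) ⧸ J))
        (_hw : (1 : tateAlgebra K (0 : Fin n → ℚ) ⧸ J) =
          ∑ k, w k • (b k : tateAlgebra K (0 : Fin n → ℚ) ⧸ J)),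
        IsGroebnerBasis m J
            ((algorithmGB (LocalArith.ofValued K) m U w).val.map
              fun g => ofPolynomial 0 g.toMvPolynomial) ∧
          (0 < n →
            (algorithmGB (LocalArith.ofValued K) m U w).ops ≤
              C * (n * Module.finrank K (tateAlgebra K (0 : Fin n → ℚ) ⧸ J) ^ 3)) := by
  refine ⟨43, ?_⟩
  intro K _ _ _ _ n m r hr I _ J _ δ b U w hU hw
  have hc : IsCoord U w fun μ => b.equivFun (monClass J μ) :=
    isCoord_monClass b hU hw
  refine ⟨isGroebnerBasis_algorithmGB m b hc, fun hn => ?_⟩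
  rw [finrank_quotient b]
  exact ops_algorithmGB_le m hc hn
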